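/- **Conventions.** All spaces are complex. An operator space is a Banach space $X$ with norms on all matrix spaces $M_n(X)$ (the norm of $M_1(X)=X$ being the given one) satisfying Ruan's axioms $\|v\oplus w\|=\max\{\|v\|,\|w\|\}$ and $\|\alpha v\beta\|\le\|\alpha\|\|v\|\|\beta\|$. A linear map $T$ is completely bounded if its amplifications $T_n:(x_{ij})\mapsto(Tx_{ij})$ are uniformly bounded, and a complete isomorphism if it is bijective and $T,T^{-1}$ are completely bounded. Subspaces carry the restricted norms, $X\oplus K$ carries the maximum of the norms on $M_n(X)\oplus M_n(K)$, and quotients carry $M_n(X/W)=M_n(X)/M_n(W)$. An extension sequence $0\to Y\xrightarrow{i}X\xrightarrow{q}Z\to0$ is a short exact sequence of operator spaces with completely bounded maps such that $i$ is a complete isomorphism onto its image and the map $X/\ker q\to Z$ induced by $q$ is a complete isomorphism; then $X$ is called a complete twisted sum of $Y$ and $Z$, and a complete extension of $Y$ if $Y=Z$. Two extension sequences $0\to Y\xrightarrow{i}X\xrightarrow{q}Z\to0$ and $0\to Y\xrightarrow{j}X'\xrightarrow{p}Z\to0$ are completely equivalent if there is a complete isomorphism $T:X\to X'$ with $Ti=j$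 and $pT=q$. **Setting.** Let $(X_0,X_1)$ be a compatible couple of operator spaces, that is, both are continuously and linearly embedded in a Hausdorff topological vector space $U$, and let $0<\theta<1$. Let $\Sigma=X_0+X_1$ with the norm $\inf\{\|x_0\|+\|x_1\|:x=x_0+x_1\}$. Let $\mathcal F$ be the space of functions $f:\{0\le\operatorname{Re}z\le1\}\to\Sigma$ that are bounded and continuous, analytic in the open strip, and such that $t\mapsto f(it)$ and $t\mapsto f(1+it)$ are bounded continuous functions from $\mathbb R$ to $X_0$ and to $X_1$ respectively. For $f\in M_n(\mathcal F)$ put $\|f\|=\max\{\sup_t\|f(it)\|_{M_n(X_0)},\sup_t\|f(1+it)\|_{M_n(X_1)}\}$. Let $\delta_\theta(f)=f(\theta)$ and let $X_\theta=\{f(\theta):f\in\mathcal F\}=\mathcal F/\ker\delta_\theta$ with the quotient operator space structure. **Proposition 3.2.** The sequence $0\to\ker\delta_\theta\to\mathcal F\xrightarrow{\delta_\theta}X_\theta\to0$ is an extension sequence, and $\delta'_\theta(f)=f'(\theta)$ defines a completely bounded map of $\ker\delta_\theta$ onto $X_\theta$. Let $\mathcal{PO}=(\mathcal F\oplus X_\theta)/\Delta$,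 where $\Delta$ is the closure of $\{(f,-f'(\theta)):f\in\ker\delta_\theta\}$, be the pushout of the inclusion $\ker\delta_\theta\to\mathcal F$ and $\delta'_\theta$, and let $$dX_\theta=\{(f(\theta),f'(\theta)):f\in\mathcal F\}=\mathcal F/(\ker\delta_\theta\cap\{f\in\mathcal F:f'(\theta)=0\})$$ with the quotient operator space structure. Then $$0\to X_\theta\xrightarrow{i}\mathcal{PO}\xrightarrow{q}X_\theta\to0,\qquad 0\to X_\theta\xrightarrow{j}dX_\theta\xrightarrow{p}X_\theta\to0,$$ where $i(x)=(0,x)+\Delta$, $q((f,x)+\Delta)=f(\theta)$, $j(y)=(0,y)$ and $p(x,y)=x$, are well defined, are extension sequences, and are completely equivalent. In particular, $dX_\theta$ is a complete extension of $X_\theta$. -/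

import Mathlib

open scoped BoundedContinuousFunction

noncomputable section

/-! ### Operator spaces -/

/-- A family of real-valued functions on the spaces `M_n(X)` of square matrices over `X`
(no axioms; the axioms are in `MatrixNorms.IsOperatorSpace`). -/
structure MatrixNorms (X : Type*) where
  /-- the value at a matrix `x ∈ M_n(X)` -/
  nrm : (n : ℕ) → Matrix (Fin n) (Fin n) X → ℝ

/-- The product `α v β ∈ M_n(X)` for `v ∈ M_m(X)` and scalar matrices `α` (`n × m`), `β` (`m × n`). -/
def matSandwich {X : Type*} [AddCommGroup X] [Module ℂ X] {m n : ℕ}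
    (α : Matrix (Fin n) (Fin m) ℂ) (v : Matrix (Fin m) (Fin m) X)
    (β : Matrix (Fin m) (Fin n) ℂ) : Matrix (Fin n) (Fin n) X :=
  fun i j => ∑ k, ∑ l, (α i k * β l j) • v k l

/-- The block diagonal matrix `v ⊕ w ∈ M_{m+n}(X)`. -/
def matDirectSum {X : Type*} [AddCommGroup X] {m n : ℕ}
    (v : Matrix (Fin m) (Fin m) X) (w : Matrix (Fin n) (Fin n) X) :
    Matrix (Fin (m + n)) (Fin (m + n)) X :=
  Matrix.reindex finSumFinEquiv finSumFinEquiv (Matrix.fromBlocks v 0 0 w)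

namespace MatrixNorms

/-- The function induced on `X = M_1(X)`. -/
def one {X : Type*} (N : MatrixNorms X) (x : X) : ℝ := N.nrm 1 (fun _ _ => x)

section

open scoped Matrix.Norms.L2Operator

/-- `N` makes the complex vector space `X` an operator space: each `N.nrm n` is a norm on `M_n(X)`,
`X` is complete for the norm of `M_1(X)`, and Ruan's two axioms hold.
Here `‖α‖` is the operator norm of a scalar matrix between Euclidean spaces. -/
structure IsOperatorSpace {X : Type*} [AddCommGroup X] [Module ℂ X] (N : MatrixNorms X) :
    Prop where
  nrm_eq_zero : ∀ (n : ℕ) (x : Matrix (Fin n) (Fin n) X), N.nrm n x = 0 ↔ x = 0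
  nrm_add_le : ∀ (n : ℕ) (x y : Matrix (Fin n) (Fin n) X),
    N.nrm n (x + y) ≤ N.nrm n x + N.nrm n y
  nrm_smul : ∀ (n : ℕ) (c : ℂ) (x : Matrix (Fin n) (Fin n) X),
    N.nrm n (c • x) = ‖c‖ * N.nrm n x
  complete : ∀ u : ℕ → X,
    (∀ ε > 0, ∃ k, ∀ m ≥ k, ∀ n ≥ k, N.one (u m - u n) < ε) →
    ∃ x, ∀ ε > 0, ∃ k, ∀ n ≥ k, N.one (u n - x) < ε
  nrm_directSum : ∀ (m n : ℕ) (v : Matrix (Fin m) (Fin m) X) (w : Matrix (Fin n) (Fin n) X),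
    N.nrm (m + n) (matDirectSum v w) = max (N.nrm m v) (N.nrm n w)
  nrm_sandwich_le : ∀ (m n : ℕ) (α : Matrix (Fin n) (Fin m) ℂ) (v : Matrix (Fin m) (Fin m) X)
    (β : Matrix (Fin m) (Fin n) ℂ),
    N.nrm n (matSandwich α v β) ≤ ‖α‖ * N.nrm m v * ‖β‖

end

variable {X Y Z : Type*} [AddCommGroup X] [Module ℂ X] [AddCommGroup Y] [Module ℂ Y]
  [AddCommGroup Z] [Module ℂ Z]

/-- The operator space structure of a subspace. -/
def restrict (N : MatrixNorms X) (W : Submodule ℂ X) : MatrixNorms W where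
  nrm n x := N.nrm n (x.map Subtype.val)

/-- The `∞`-direct sum: `M_n(X ⊕ Y) = M_n(X) ⊕ M_n(Y)` with the maximum of the norms. -/
def prod (N : MatrixNorms X) (N' : MatrixNorms Y) : MatrixNorms (X × Y) where
  nrm n x := max (N.nrm n (x.map Prod.fst)) (N'.nrm n (x.map Prod.snd))

/-- For a surjective linear map `L : X → Y`, the quotient structure on `Y ≅ X / ker L`:
`M_n(Y) = M_n(X) / M_n(ker L)`, that is, `‖y‖ = inf {‖x‖ : x ∈ M_n(X), L_n x = y}`. -/
def quotientAlong (N : MatrixNorms X) (L : X →ₗ[ℂ] Y) : MatrixNorms Y where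
  nrm n y := sInf {r : ℝ | ∃ x : Matrix (Fin n) (Fin n) X, x.map L = y ∧ N.nrm n x = r}

/-- The quotient operator space structure on `X / W`. -/
def quotient (N : MatrixNorms X) (W : Submodule ℂ X) : MatrixNorms (X ⧸ W) :=
  N.quotientAlong W.mkQ

/-- `W` is closed for the norm of `M_1(X) = X`. -/
def IsClosedSubspace (N : MatrixNorms X) (W : Submodule ℂ X) : Prop :=
  ∀ x : X, (∀ ε > 0, ∃ w ∈ W, N.one (x - w) < ε) → x ∈ W

/-- The closure of a subspace: the smallest closed subspace that contains it. -/
def closure (N : MatrixNorms X) (W : Submodule ℂ X) : Submodule ℂ X :=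
  sInf {W' : Submodule ℂ X | W ≤ W' ∧ N.IsClosedSubspace W'}

end MatrixNorms

variable {X Y Z K : Type*} [AddCommGroup X] [Module ℂ X] [AddCommGroup Y] [Module ℂ Y]
  [AddCommGroup Z] [Module ℂ Z] [AddCommGroup K] [Module ℂ K]

/-- `T` is completely bounded: `sup_n ‖T_n‖ < ∞`. -/
def IsCompletelyBounded (NX : MatrixNorms X) (NY : MatrixNorms Y) (T : X →ₗ[ℂ] Y) : Prop :=
  ∃ C : ℝ, ∀ (n : ℕ) (x : Matrix (Fin n) (Fin n) X), NY.nrm n (x.map T) ≤ C * NX.nrm n x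

/-- `T` is a complete isomorphism: it is bijective, and it and its inverse are completely bounded. -/
def IsCompleteIso (NX : MatrixNorms X) (NY : MatrixNorms Y) (T : X →ₗ[ℂ] Y) : Prop :=
  ∃ e : X ≃ₗ[ℂ] Y, (e : X →ₗ[ℂ] Y) = T ∧
    IsCompletelyBounded NX NY (e : X →ₗ[ℂ] Y) ∧ IsCompletelyBounded NY NX (e.symm : Y →ₗ[ℂ] X)

/-- `0 → Y → X → Z → 0` (with maps `i`, `q`) is an extension sequence of operator spaces:
a short exact sequence with completely bounded maps, such that `i` is a complete isomorphism onto
its image and `q` induces a complete isomorphism from `X / ker q` onto `Z`. -/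
structure IsExtensionSequence (NY : MatrixNorms Y) (NX : MatrixNorms X) (NZ : MatrixNorms Z)
    (i : Y →ₗ[ℂ] X) (q : X →ₗ[ℂ] Z) : Prop where
  left_operatorSpace : NY.IsOperatorSpace
  mid_operatorSpace : NX.IsOperatorSpace
  right_operatorSpace : NZ.IsOperatorSpace
  injective : Function.Injective i
  exact : Function.Exact i q
  surjective : Function.Surjective q
  left_cb : IsCompletelyBounded NY NX i
  right_cb : IsCompletelyBounded NX NZ q
  left_iso : IsCompleteIso NY (NX.restrict (LinearMap.range i)) i.rangeRestrict
  right_iso : IsCompleteIso (NX.quotient (LinearMap.ker q)) NZ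
    ((LinearMap.ker q).liftQ q le_rfl)

/-- The sequences `0 → Y → X → Z → 0` (maps `i`, `q`) and `0 → Y → X' → Z → 0` (maps `j`, `p`) are
completely equivalent extension sequences: both are extension sequences, and there is a complete
isomorphism `T : X → X'` with `T ∘ i = j` and `p ∘ T = q`. -/
def CompletelyEquivalent {X' : Type*} [AddCommGroup X'] [Module ℂ X']
    (NY : MatrixNorms Y) (NX : MatrixNorms X) (NX' : MatrixNorms X') (NZ : MatrixNorms Z)
    (i : Y →ₗ[ℂ] X) (q : X →ₗ[ℂ] Z) (j : Y →ₗ[ℂ] X') (p : X' →ₗ[ℂ] Z) : Prop :=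
  IsExtensionSequence NY NX NZ i q ∧ IsExtensionSequence NY NX' NZ j p ∧
    ∃ T : X →ₗ[ℂ] X', IsCompleteIso NX NX' T ∧ T ∘ₗ i = j ∧ p ∘ₗ T = q

/-! ### Pushout -/

/-- `Δ`, the closure in `X ⊕ K` of `{(A y, -B y) : y ∈ Y}`. -/
def pushoutKernel (NX : MatrixNorms X) (NK : MatrixNorms K) (A : Y →ₗ[ℂ] X) (B : Y →ₗ[ℂ] K) :
    Submodule ℂ (X × K) :=
  (NX.prod NK).closure (LinearMap.range (A.prod (-B)))

/-- The pushout `(X ⊕ K) / Δ` of `A : Y → X` and `B : Y → K`. -/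
def Pushout (NX : MatrixNorms X) (NK : MatrixNorms K) (A : Y →ₗ[ℂ] X) (B : Y →ₗ[ℂ] K) : Type _ :=
  (X × K) ⧸ pushoutKernel NX NK A B

instance (NX : MatrixNorms X) (NK : MatrixNorms K) (A : Y →ₗ[ℂ] X) (B : Y →ₗ[ℂ] K) :
    AddCommGroup (Pushout NX NK A B) :=
  inferInstanceAs (AddCommGroup ((X × K) ⧸ pushoutKernel NX NK A B))

instance (NX : MatrixNorms X) (NK : MatrixNorms K) (A : Y →ₗ[ℂ] X) (B : Y →ₗ[ℂ] K) :
    Module ℂ (Pushout NX NK A B) :=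
  inferInstanceAs (Module ℂ ((X × K) ⧸ pushoutKernel NX NK A B))

/-- The operator space structure of the pushout. -/
def pushoutNorms (NX : MatrixNorms X) (NK : MatrixNorms K) (A : Y →ₗ[ℂ] X) (B : Y →ₗ[ℂ] K) :
    MatrixNorms (Pushout NX NK A B) :=
  (NX.prod NK).quotient (pushoutKernel NX NK A B)

/-- The class `(x, k) + Δ`, as a linear map. -/
def pushoutMk (NX : MatrixNorms X) (NK : MatrixNorms K) (A : Y →ₗ[ℂ] X) (B : Y →ₗ[ℂ] K) :
    X × K →ₗ[ℂ] Pushout NX NK A B :=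
  (pushoutKernel NX NK A B).mkQ

/-- The map `k ↦ (0, k) + Δ`. -/
def pushoutInr (NX : MatrixNorms X) (NK : MatrixNorms K) (A : Y →ₗ[ℂ] X) (B : Y →ₗ[ℂ] K) :
    K →ₗ[ℂ] Pushout NX NK A B :=
  pushoutMk NX NK A B ∘ₗ LinearMap.inr ℂ X K

/-! ### Complex interpolation -/

/-- A compatible couple: continuous linear injections of `X₀` and `X₁` into a space `U`
(used for Hausdorff topological vector spaces `U`). -/
structure CompatibleCouple (X₀ X₁ U : Type*) [NormedAddCommGroup X₀] [NormedSpace ℂ X₀]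
    [NormedAddCommGroup X₁] [NormedSpace ℂ X₁] [AddCommGroup U] [Module ℂ U]
    [TopologicalSpace U] where
  ι₀ : X₀ →L[ℂ] U
  ι₁ : X₁ →L[ℂ] U
  injective₀ : Function.Injective ι₀
  injective₁ : Function.Injective ι₁

namespace CompatibleCouple

variable {X₀ X₁ U : Type*} [NormedAddCommGroup X₀] [NormedSpace ℂ X₀]
  [NormedAddCommGroup X₁] [NormedSpace ℂ X₁] [AddCommGroup U] [Module ℂ U] [TopologicalSpace U]

/-- The subspace `{x₀ + x₁ : x₀ ∈ X₀, x₁ ∈ X₁}` of `U`. -/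
def sumSubspace (c : CompatibleCouple X₀ X₁ U) : Submodule ℂ U :=
  LinearMap.range (c.ι₀ : X₀ →ₗ[ℂ] U) ⊔ LinearMap.range (c.ι₁ : X₁ →ₗ[ℂ] U)

/-- The sum space `Σ = X₀ + X₁`. It carries its own norm, not the topology of `U`. -/
def Sum (c : CompatibleCouple X₀ X₁ U) : Type _ := c.sumSubspace

section SumNorm

/-- Auxiliary: the vector space operations of `Σ`. -/
abbrev sumAddCommGroup (c : CompatibleCouple X₀ X₁ U) : AddCommGroup c.Sum :=
  inferInstanceAs (AddCommGroup c.sumSubspace)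

attribute [local instance] sumAddCommGroup

/-- Auxiliary: the vector space operations of `Σ`. -/
abbrev sumModule (c : CompatibleCouple X₀ X₁ U) : Module ℂ c.Sum :=
  inferInstanceAs (Module ℂ c.sumSubspace)

attribute [local instance] sumModule

/-- The norm of the sum space: `‖x‖ = inf {‖x₀‖ + ‖x₁‖ : x = x₀ + x₁}`. -/
instance (c : CompatibleCouple X₀ X₁ U) : Norm c.Sum where
  norm x := sInf {r : ℝ | ∃ x₀ x₁, c.ι₀ x₀ + c.ι₁ x₁ = x.1 ∧ ‖x₀‖ + ‖x₁‖ = r}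

theorem exists_decomp (c : CompatibleCouple X₀ X₁ U) (x : c.Sum) :
    ∃ x₀ x₁, c.ι₀ x₀ + c.ι₁ x₁ = x.1 := by
  obtain ⟨x, hx⟩ := x
  obtain ⟨_, ⟨x₀, rfl⟩, _, ⟨x₁, rfl⟩, h⟩ := Submodule.mem_sup.1 hx
  exact ⟨x₀, x₁, h⟩

theorem norm_le_of_decomp (c : CompatibleCouple X₀ X₁ U) {x : c.Sum} {x₀ : X₀} {x₁ : X₁}
    (h : c.ι₀ x₀ + c.ι₁ x₁ = x.1) : ‖x‖ ≤ ‖x₀‖ + ‖x₁‖ := by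
  refine csInf_le ⟨0, ?_⟩ ⟨x₀, x₁, h, rfl⟩
  rintro r ⟨a, b, -, rfl⟩
  positivity

theorem exists_decomp_lt (c : CompatibleCouple X₀ X₁ U) (x : c.Sum) {r : ℝ} (hr : ‖x‖ < r) :
    ∃ x₀ x₁, c.ι₀ x₀ + c.ι₁ x₁ = x.1 ∧ ‖x₀‖ + ‖x₁‖ < r := by
  obtain ⟨a, b, hab⟩ := c.exists_decomp x
  obtain ⟨_, ⟨x₀, x₁, h, rfl⟩, hlt⟩ :=
    exists_lt_of_csInf_lt (s := {r : ℝ | ∃ x₀ x₁, c.ι₀ x₀ + c.ι₁ x₁ = x.1 ∧ ‖x₀‖ + ‖x₁‖ = r})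
      ⟨_, a, b, hab, rfl⟩ hr
  exact ⟨x₀, x₁, h, hlt⟩

theorem sum_norm_nonneg (c : CompatibleCouple X₀ X₁ U) (x : c.Sum) : 0 ≤ ‖x‖ := by
  refine Real.sInf_nonneg ?_
  rintro r ⟨a, b, -, rfl⟩
  positivity

theorem sum_norm_smul_le (c : CompatibleCouple X₀ X₁ U) (a : ℂ) (x : c.Sum) :
    ‖a • x‖ ≤ ‖a‖ * ‖x‖ := by
  refine le_of_forall_pos_le_add fun ε hε => ?_
  have h1 : 0 < ‖a‖ + 1 := by positivity
  obtain ⟨x₀, x₁, h, hlt⟩ := c.exists_decomp_lt x (lt_add_of_pos_right ‖x‖ (div_pos hε h1))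
  have h2 : ‖a • x‖ ≤ ‖a • x₀‖ + ‖a • x₁‖ :=
    c.norm_le_of_decomp (by rw [map_smul, map_smul, ← smul_add, h]; rfl)
  rw [norm_smul a x₀, norm_smul a x₁, ← mul_add] at h2
  have h3 : ‖a‖ * (ε / (‖a‖ + 1)) ≤ ε := by
    rw [mul_div_assoc', div_le_iff₀ h1]
    nlinarith [norm_nonneg a]
  nlinarith [mul_le_mul_of_nonneg_left hlt.le (norm_nonneg a)]

theorem normedSpaceCore (c : CompatibleCouple X₀ X₁ U) [IsTopologicalAddGroup U] [T2Space U] :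
    NormedSpace.Core ℂ c.Sum where
  norm_nonneg := c.sum_norm_nonneg
  norm_smul a x := by
    refine le_antisymm (c.sum_norm_smul_le a x) ?_
    rcases eq_or_ne a 0 with rfl | ha
    · simpa using c.sum_norm_nonneg _
    · have h := c.sum_norm_smul_le a⁻¹ (a • x)
      rw [inv_smul_smul₀ ha, norm_inv] at h
      have ha' : 0 < ‖a‖ := norm_pos_iff.2 ha
      calc ‖a‖ * ‖x‖ ≤ ‖a‖ * (‖a‖⁻¹ * ‖a • x‖) := by gcongr
        _ = ‖a • x‖ := by field_simp
  norm_triangle x y := by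
    refine le_of_forall_pos_le_add fun ε hε => ?_
    obtain ⟨x₀, x₁, h, hlt⟩ := c.exists_decomp_lt x (lt_add_of_pos_right ‖x‖ (half_pos hε))
    obtain ⟨y₀, y₁, h', hlt'⟩ := c.exists_decomp_lt y (lt_add_of_pos_right ‖y‖ (half_pos hε))
    have h2 : ‖x + y‖ ≤ ‖x₀ + y₀‖ + ‖x₁ + y₁‖ := by
      refine c.norm_le_of_decomp ?_
      have h3 : (x + y).1 = x.1 + y.1 := rfl
      rw [map_add, map_add, h3, ← h, ← h']
      abel
    have := norm_add_le x₀ y₀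
    have := norm_add_le x₁ y₁
    linarith
  norm_eq_zero_iff x := by
    constructor
    · intro hx
      have key : ∀ n : ℕ, ∃ p : X₀ × X₁, c.ι₀ p.1 + c.ι₁ p.2 = x.1 ∧
          ‖p.1‖ + ‖p.2‖ < 1 / ((n : ℝ) + 1) := fun n => by
        obtain ⟨x₀, x₁, h⟩ := c.exists_decomp_lt x
          (r := 1 / ((n : ℝ) + 1)) (by rw [hx]; positivity)
        exact ⟨(x₀, x₁), h⟩
      choose p hp hlt using key
      have t0 : Filter.Tendsto (fun n => (p n).1) Filter.atTop (nhds 0) :=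
        squeeze_zero_norm (fun n => by linarith [hlt n, norm_nonneg (p n).2])
          tendsto_one_div_add_atTop_nhds_zero_nat
      have t1 : Filter.Tendsto (fun n => (p n).2) Filter.atTop (nhds 0) :=
        squeeze_zero_norm (fun n => by linarith [hlt n, norm_nonneg (p n).1])
          tendsto_one_div_add_atTop_nhds_zero_nat
      have t := ((c.ι₀.continuous.tendsto 0).comp t0).add ((c.ι₁.continuous.tendsto 0).comp t1)
      rw [map_zero, map_zero, add_zero] at t
      exact Subtype.ext (tendsto_nhds_unique tendsto_const_nhds (Filter.Tendsto.congr hp t))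
    · rintro rfl
      refine le_antisymm ?_ (c.sum_norm_nonneg 0)
      have h0 : (0 : c.Sum).1 = 0 := rfl
      simpa using c.norm_le_of_decomp (x := 0) (x₀ := 0) (x₁ := 0) (by simp [h0])

instance (c : CompatibleCouple X₀ X₁ U) [IsTopologicalAddGroup U] [T2Space U] :
    NormedAddCommGroup c.Sum :=
  NormedAddCommGroup.ofCore c.normedSpaceCore

instance (c : CompatibleCouple X₀ X₁ U) [IsTopologicalAddGroup U] [T2Space U] :
    NormedSpace ℂ c.Sum :=
  NormedSpace.ofCore c.normedSpaceCore

end SumNorm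

variable [IsTopologicalAddGroup U] [T2Space U]

/-- The inclusion `X₀ ⊆ Σ`. -/
def inl (c : CompatibleCouple X₀ X₁ U) : X₀ →ₗ[ℂ] c.Sum :=
  (c.ι₀ : X₀ →ₗ[ℂ] U).codRestrict c.sumSubspace
    (fun x => Submodule.mem_sup_left ⟨x, rfl⟩)

/-- The inclusion `X₁ ⊆ Σ`. -/
def inr (c : CompatibleCouple X₀ X₁ U) : X₁ →ₗ[ℂ] c.Sum :=
  (c.ι₁ : X₁ →ₗ[ℂ] U).codRestrict c.sumSubspace
    (fun x => Submodule.mem_sup_right ⟨x, rfl⟩)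

/-- Calderón's space `F`. An element is a function `f` on the closed strip `0 ≤ Re z ≤ 1` with
values in `Σ` (extended by zero outside the strip) together with its boundary functions
`g₀ t = f (i t)` and `g₁ t = f (1 + i t)`, as elements of `X₀` and `X₁` (they are determined by `f`,
as `X₀` and `X₁` embed into `Σ`). The function `f` is bounded and continuous on the closed strip and
analytic on the open strip, and `g₀ : ℝ → X₀`, `g₁ : ℝ → X₁` are bounded and continuous. -/
def calderonSubmodule (c : CompatibleCouple X₀ X₁ U) :
    Submodule ℂ ((ℂ → c.Sum) × (ℝ →ᵇ X₀) × (ℝ →ᵇ X₁)) where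
  carrier := {f |
    (∀ z : ℂ, z.re ∉ Set.Icc (0 : ℝ) 1 → f.1 z = 0) ∧
    ContinuousOn f.1 {z : ℂ | z.re ∈ Set.Icc (0 : ℝ) 1} ∧
    (∃ C : ℝ, ∀ z : ℂ, ‖f.1 z‖ ≤ C) ∧
    DifferentiableOn ℂ f.1 {z : ℂ | z.re ∈ Set.Ioo (0 : ℝ) 1} ∧
    (∀ t : ℝ, f.1 (t * Complex.I) = c.inl (f.2.1 t)) ∧
    (∀ t : ℝ, f.1 (1 + t * Complex.I) = c.inr (f.2.2 t))}
  add_mem' := by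
    rintro f g ⟨a1, a2, ⟨C, hC⟩, a4, a5, a6⟩ ⟨b1, b2, ⟨D, hD⟩, b4, b5, b6⟩
    refine ⟨fun z hz => ?_, a2.add b2, ⟨C + D, fun z => ?_⟩, a4.add b4, fun t => ?_, fun t => ?_⟩
    · simp [a1 z hz, b1 z hz]
    · exact (norm_add_le _ _).trans (add_le_add (hC z) (hD z))
    · simp [a5 t, b5 t]
    · simp [a6 t, b6 t]
  zero_mem' := by
    refine ⟨fun z hz => rfl, continuousOn_const, ⟨0, fun z => ?_⟩, differentiableOn_const _,
      fun t => ?_, fun t => ?_⟩ <;> simp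
  smul_mem' := by
    rintro a f ⟨a1, a2, ⟨C, hC⟩, a4, a5, a6⟩
    refine ⟨fun z hz => ?_, a2.const_smul a, ⟨‖a‖ * C, fun z => ?_⟩, a4.const_smul a,
      fun t => ?_, fun t => ?_⟩
    · simp [a1 z hz]
    · rw [Prod.smul_fst, Pi.smul_apply, norm_smul]
      exact mul_le_mul_of_nonneg_left (hC z) (norm_nonneg a)
    · simp [a5 t]
    · simp [a6 t]

/-- Calderón's space `F`, as a type. -/
def Calderon (c : CompatibleCouple X₀ X₁ U) : Type _ := c.calderonSubmodule

instance (c : CompatibleCouple X₀ X₁ U) : AddCommGroup c.Calderon :=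
  inferInstanceAs (AddCommGroup c.calderonSubmodule)

instance (c : CompatibleCouple X₀ X₁ U) : Module ℂ c.Calderon :=
  inferInstanceAs (Module ℂ c.calderonSubmodule)

/-- The operator space structure of `F`: for `f ∈ M_n(F)`,
`‖f‖ = max (sup_t ‖f(it)‖_{M_n(X₀)}) (sup_t ‖f(1+it)‖_{M_n(X₁)})`. -/
def calderonNorms (c : CompatibleCouple X₀ X₁ U) (N₀ : MatrixNorms X₀) (N₁ : MatrixNorms X₁) :
    MatrixNorms c.Calderon where
  nrm n f := max (⨆ t : ℝ, N₀.nrm n (f.map fun a => a.1.2.1 t))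
    (⨆ t : ℝ, N₁.nrm n (f.map fun a => a.1.2.2 t))

/-- The evaluation `δ_θ : F → Σ`, `f ↦ f(θ)`. -/
def eval (c : CompatibleCouple X₀ X₁ U) (θ : ℝ) : c.Calderon →ₗ[ℂ] c.Sum where
  toFun f := f.1.1 (θ : ℂ)
  map_add' _ _ := rfl
  map_smul' _ _ := rfl

theorem differentiableAt_of_mem (c : CompatibleCouple X₀ X₁ U) {θ : ℝ}
    (hθ : θ ∈ Set.Ioo (0 : ℝ) 1) (f : c.Calderon) : DifferentiableAt ℂ f.1.1 (θ : ℂ) :=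
  f.2.2.2.2.1.differentiableAt
    ((isOpen_Ioo.preimage Complex.continuous_re).mem_nhds (by simpa using hθ))

/-- The evaluation of the derivative `f ↦ f'(θ)`, with values in `Σ`, for `0 < θ < 1`. -/
def evalDeriv (c : CompatibleCouple X₀ X₁ U) (θ : ℝ) (hθ : θ ∈ Set.Ioo (0 : ℝ) 1) :
    c.Calderon →ₗ[ℂ] c.Sum where
  toFun f := deriv f.1.1 (θ : ℂ)
  map_add' f g := deriv_add (c.differentiableAt_of_mem hθ f) (c.differentiableAt_of_mem hθ g)
  map_smul' a f := deriv_const_smul a (c.differentiableAt_of_mem hθ f)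

/-- The interpolation space `X_θ = {f(θ) : f ∈ F} ≅ F / ker δ_θ`. -/
abbrev interp (c : CompatibleCouple X₀ X₁ U) (θ : ℝ) : Submodule ℂ c.Sum :=
  LinearMap.range (c.eval θ)

/-- The evaluation `δ_θ` as a map of `F` onto `X_θ`. -/
abbrev evalInterp (c : CompatibleCouple X₀ X₁ U) (θ : ℝ) : c.Calderon →ₗ[ℂ] c.interp θ :=
  (c.eval θ).rangeRestrict

/-- The operator space structure of `X_θ = F / ker δ_θ`. -/
def interpNorms (c : CompatibleCouple X₀ X₁ U) (N₀ : MatrixNorms X₀) (N₁ : MatrixNorms X₁)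
    (θ : ℝ) : MatrixNorms (c.interp θ) :=
  (c.calderonNorms N₀ N₁).quotientAlong (c.evalInterp θ)

/-- The kernel of `δ_θ`. -/
abbrev evalKer (c : CompatibleCouple X₀ X₁ U) (θ : ℝ) : Submodule ℂ c.Calderon :=
  LinearMap.ker (c.eval θ)

/-- The operator space structure of `ker δ_θ`, as a subspace of `F`. -/
def evalKerNorms (c : CompatibleCouple X₀ X₁ U) (N₀ : MatrixNorms X₀) (N₁ : MatrixNorms X₁)
    (θ : ℝ) : MatrixNorms (c.evalKer θ) :=
  (c.calderonNorms N₀ N₁).restrict (c.evalKer θ)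

/-- The map `f ↦ (f(θ), f'(θ))`; its kernel is `ker δ_θ ∩ ker δ'_θ`. -/
def jet (c : CompatibleCouple X₀ X₁ U) (θ : ℝ) (hθ : θ ∈ Set.Ioo (0 : ℝ) 1) :
    c.Calderon →ₗ[ℂ] c.Sum × c.Sum :=
  (c.eval θ).prod (c.evalDeriv θ hθ)

/-- The space `dX_θ = {(f(θ), f'(θ)) : f ∈ F} ≅ F / (ker δ_θ ∩ ker δ'_θ)`. -/
abbrev derived (c : CompatibleCouple X₀ X₁ U) (θ : ℝ) (hθ : θ ∈ Set.Ioo (0 : ℝ) 1) :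
    Submodule ℂ (c.Sum × c.Sum) :=
  LinearMap.range (c.jet θ hθ)

/-- The quotient operator space structure of `dX_θ = F / (ker δ_θ ∩ ker δ'_θ)`. -/
def derivedNorms (c : CompatibleCouple X₀ X₁ U) (N₀ : MatrixNorms X₀) (N₁ : MatrixNorms X₁)
    (θ : ℝ) (hθ : θ ∈ Set.Ioo (0 : ℝ) 1) : MatrixNorms (c.derived θ hθ) :=
  (c.calderonNorms N₀ N₁).quotientAlong (c.jet θ hθ).rangeRestrict

/-- The map `p : dX_θ → X_θ`, `p(x, y) = x`. -/
def derivedFst (c : CompatibleCouple X₀ X₁ U) (θ : ℝ) (hθ : θ ∈ Set.Ioo (0 : ℝ) 1) :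
    c.derived θ hθ →ₗ[ℂ] c.interp θ :=
  (LinearMap.fst ℂ c.Sum c.Sum ∘ₗ (c.derived θ hθ).subtype).codRestrict (c.interp θ) (by
    rintro ⟨_, f, rfl⟩
    exact ⟨f, rfl⟩)

end CompatibleCouple

end

/-! Write `F` for Calderón's space, `δ` for evaluation at `θ` and `φ(z) = (θ+1)(z-θ)/(z+1)`. By the
maximum principle an element of `F` is determined by its boundary values, and the pairs of boundary
functions that occur form a closed subspace of the bounded continuous functions on the two boundary
lines. So `F` is an operator space (`isOperatorSpace_calderonNorms`). Evaluation at `θ` and, by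
Cauchy's estimate, evaluation of the derivative are bounded into `Σ`; the kernels of `δ` and of the
jet `f ↦ (f(θ), f'(θ))` are therefore closed, and `X_θ` and `dX_θ` are operator spaces.

The analytic core is that `φ` is bounded on the strip, has a simple zero at `θ` with derivative 1,
and has a bounded inverse on the boundary lines. If `f(θ) = 0`, then `g = f/φ` lies in `F` and `g(θ)
= f'(θ)` (`exists_div_factor`); if `g ∈ F`, then `f = φ g` has `f(θ) = 0` and `f'(θ) = g(θ)`
(`exists_mul_factor`). On the boundary both operations multiply by scalar functions, which costs the
same constant for every matrix size. Hence `δ'` is completely bounded onto `X_θ`, and matrices over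
`X_θ` lift along `δ'` with uniform control.

The rest is formal. The pushout of an extension sequence along a completely bounded map is an
extension sequence (`IsExtensionSequence.pushout`). The map `T : (f, x) + Δ ↦ (f(θ), f'(θ)) + (0,
x)` is a complete isomorphism (`pushout_isCompleteIso`): choosing `f₀ ∈ ker δ` with `f₀'(θ) = x`
gives `(f, x) ≡ (f + f₀, 0)` modulo `Δ`, so bounded lifting along `δ'` bounds `T`, while the inverse
is contractive because `dX_θ` carries the quotient norms of `F`. Since `T` intertwines the maps of
the two sequences, the one for `dX_θ` inherits exactness and all estimates from the pushout. -/

noncomputable section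

/-! ### Operator spaces: basic facts -/

/-! ### Scalar matrices that select rows and columns -/

section Selection

open scoped Matrix.Norms.L2Operator

/-- The isometry `ℂⁿ → ℂᵐ` that sends the basis vector `j` to the basis vector `e j`. -/
def selectionMatrix {m n : ℕ} (e : Fin n → Fin m) : Matrix (Fin m) (Fin n) ℂ :=
  fun i j => if i = e j then 1 else 0

/-- Distinct basis vectors go to distinct basis vectors, so `S* S = 1` and the C*-identity applies.
Only `≤ 1` is claimed because the norm is 0 for `n = 0`. -/
theorem norm_selectionMatrix_le {m n : ℕ} {e : Fin n → Fin m} (he : Function.Injective e) :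
    ‖selectionMatrix e‖ ≤ 1 := by
  have h : (selectionMatrix e).conjTranspose * selectionMatrix e = Matrix.diagonal 1 := by
    ext i j
    simp [Matrix.mul_apply, selectionMatrix, Matrix.diagonal_apply, he.eq_iff, eq_comm]
  have h1 := Matrix.l2_opNorm_conjTranspose_mul_self (selectionMatrix e)
  rw [h, Matrix.l2_opNorm_diagonal] at h1
  have h2 : ‖(1 : Fin n → ℂ)‖ ≤ 1 := (pi_norm_le_iff_of_nonneg zero_le_one).2 (by simp)
  nlinarith [norm_nonneg (selectionMatrix e)]

theorem norm_selectionMatrix_conjTranspose_le {m n : ℕ} {e : Fin n → Fin m}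
    (he : Function.Injective e) : ‖(selectionMatrix e).conjTranspose‖ ≤ 1 := by
  rw [Matrix.l2_opNorm_conjTranspose]
  exact norm_selectionMatrix_le he

end Selection

/-- This is how the sandwich axiom controls submatrices, in particular entries and diagonal blocks.
-/
theorem matSandwich_selectionMatrix {X : Type*} [AddCommGroup X] [Module ℂ X] {m n : ℕ}
    (e f : Fin n → Fin m) (v : Matrix (Fin m) (Fin m) X) :
    matSandwich (selectionMatrix e).conjTranspose v (selectionMatrix f) = v.submatrix e f := by
  ext i j
  simp [matSandwich, selectionMatrix, apply_ite, ite_smul]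

theorem matSandwich_selectionMatrix_conjTranspose {X : Type*} [AddCommGroup X] [Module ℂ X]
    {n : ℕ} (i j : Fin n) (x : X) :
    matSandwich (selectionMatrix fun _ : Fin 1 => i) (fun _ _ => x)
      (selectionMatrix fun _ : Fin 1 => j).conjTranspose = Matrix.single i j x := by
  ext k l
  simp [matSandwich, selectionMatrix, Matrix.single_apply, eq_comm, ite_and]
  split_ifs <;> rfl

theorem matSandwich_map {X Y : Type*} [AddCommGroup X] [Module ℂ X] [AddCommGroup Y] [Module ℂ Y]
    (L : X →ₗ[ℂ] Y) {m n : ℕ} (α : Matrix (Fin n) (Fin m) ℂ) (v : Matrix (Fin m) (Fin m) X)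
    (β : Matrix (Fin m) (Fin n) ℂ) :
    (matSandwich α v β).map L = matSandwich α (v.map L) β := by
  ext i j
  simp [matSandwich]

theorem matDirectSum_map {X Y : Type*} [AddCommGroup X] [Module ℂ X] [AddCommGroup Y] [Module ℂ Y]
    (L : X →ₗ[ℂ] Y) {m n : ℕ} (v : Matrix (Fin m) (Fin m) X) (w : Matrix (Fin n) (Fin n) X) :
    (matDirectSum v w).map L = matDirectSum (v.map L) (w.map L) := by
  simp only [matDirectSum, Matrix.reindex_apply, ← Matrix.submatrix_map, Matrix.fromBlocks_map]
  congr 2 <;> ext <;> simp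

theorem matDirectSum_submatrix_castAdd {X : Type*} [AddCommGroup X] [Module ℂ X] {m n : ℕ}
    (v : Matrix (Fin m) (Fin m) X) (w : Matrix (Fin n) (Fin n) X) :
    (matDirectSum v w).submatrix (Fin.castAdd n) (Fin.castAdd n) = v := by
  ext i j
  simp [matDirectSum]

theorem matDirectSum_submatrix_natAdd {X : Type*} [AddCommGroup X] [Module ℂ X] {m n : ℕ}
    (v : Matrix (Fin m) (Fin m) X) (w : Matrix (Fin n) (Fin n) X) :
    (matDirectSum v w).submatrix (Fin.natAdd m) (Fin.natAdd m) = w := by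
  ext i j
  simp [matDirectSum]

namespace MatrixNorms

variable {X Y Z K : Type*} [AddCommGroup X] [Module ℂ X] [AddCommGroup Y] [Module ℂ Y]
  [AddCommGroup Z] [Module ℂ Z] [AddCommGroup K] [Module ℂ K]

namespace IsOperatorSpace

variable {N : MatrixNorms X}

theorem nrm_zero (h : N.IsOperatorSpace) (n : ℕ) : N.nrm n 0 = 0 := (h.nrm_eq_zero n 0).2 rfl

theorem nrm_neg (h : N.IsOperatorSpace) (n : ℕ) (x : Matrix (Fin n) (Fin n) X) :
    N.nrm n (-x) = N.nrm n x := by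
  simpa using h.nrm_smul n (-1) x

theorem nrm_nonneg (h : N.IsOperatorSpace) (n : ℕ) (x : Matrix (Fin n) (Fin n) X) :
    0 ≤ N.nrm n x := by
  have := h.nrm_add_le n x (-x)
  rw [add_neg_cancel, h.nrm_zero, h.nrm_neg] at this
  linarith

theorem nrm_submatrix_le (h : N.IsOperatorSpace) {m n : ℕ} {e f : Fin n → Fin m}
    (he : Function.Injective e) (hf : Function.Injective f) (v : Matrix (Fin m) (Fin m) X) :
    N.nrm n (v.submatrix e f) ≤ N.nrm m v := by
  have h1 := h.nrm_sandwich_le m n (selectionMatrix e).conjTranspose v (selectionMatrix f)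
  rw [matSandwich_selectionMatrix] at h1
  have h2 := norm_selectionMatrix_conjTranspose_le he
  have h3 := norm_selectionMatrix_le hf
  have h4 := h.nrm_nonneg m v
  refine h1.trans ((mul_le_of_le_one_right (mul_nonneg ?_ h4) h3).trans
    (mul_le_of_le_one_left h4 h2))
  open scoped Matrix.Norms.L2Operator in exact norm_nonneg _

theorem one_apply_le (h : N.IsOperatorSpace) {n : ℕ} (x : Matrix (Fin n) (Fin n) X)
    (i j : Fin n) : N.one (x i j) ≤ N.nrm n x :=
  h.nrm_submatrix_le (e := fun _ : Fin 1 => i) (f := fun _ : Fin 1 => j)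
    (Function.injective_of_subsingleton _) (Function.injective_of_subsingleton _) x

theorem nrm_single_le (h : N.IsOperatorSpace) {n : ℕ} (i j : Fin n) (x : X) :
    N.nrm n (Matrix.single i j x) ≤ N.one x := by
  have h1 := h.nrm_sandwich_le 1 n (selectionMatrix fun _ : Fin 1 => i) (fun _ _ => x)
    (selectionMatrix fun _ : Fin 1 => j).conjTranspose
  rw [matSandwich_selectionMatrix_conjTranspose] at h1
  have h2 := norm_selectionMatrix_le (e := fun _ : Fin 1 => i)
    (Function.injective_of_subsingleton _)
  have h3 := norm_selectionMatrix_conjTranspose_le (e := fun _ : Fin 1 => j)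
    (Function.injective_of_subsingleton _)
  have h4 := h.nrm_nonneg 1 (fun _ _ => x)
  refine h1.trans ((mul_le_of_le_one_right (mul_nonneg ?_ h4) h3).trans
    (mul_le_of_le_one_left h4 h2))
  open scoped Matrix.Norms.L2Operator in exact norm_nonneg _

theorem nrm_sum_le (h : N.IsOperatorSpace) {n : ℕ} {ι : Type*} (s : Finset ι)
    (x : ι → Matrix (Fin n) (Fin n) X) : N.nrm n (∑ i ∈ s, x i) ≤ ∑ i ∈ s, N.nrm n (x i) :=
  Finset.le_sum_of_subadditive (N.nrm n) (h.nrm_zero n).le (h.nrm_add_le n) s x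

/-- A matrix is the sum of its one-entry matrices, each a sandwich of a `1 × 1` matrix between
contractions. The bound makes suprema of matrix norms over the boundary lines finite. -/
theorem nrm_le_sum_one (h : N.IsOperatorSpace) {n : ℕ} (x : Matrix (Fin n) (Fin n) X) :
    N.nrm n x ≤ ∑ i, ∑ j, N.one (x i j) := by
  conv_lhs => rw [Matrix.matrix_eq_sum_single x]
  refine (h.nrm_sum_le _ _).trans (Finset.sum_le_sum fun i _ => ?_)
  exact (h.nrm_sum_le _ _).trans (Finset.sum_le_sum fun j _ => h.nrm_single_le i j _)

theorem one_nonneg (h : N.IsOperatorSpace) (x : X) : 0 ≤ N.one x := h.nrm_nonneg 1 _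

theorem one_add_le (h : N.IsOperatorSpace) (x y : X) : N.one (x + y) ≤ N.one x + N.one y :=
  h.nrm_add_le 1 _ _

theorem one_smul (h : N.IsOperatorSpace) (c : ℂ) (x : X) : N.one (c • x) = ‖c‖ * N.one x :=
  h.nrm_smul 1 c _

theorem one_eq_zero (h : N.IsOperatorSpace) {x : X} : N.one x = 0 ↔ x = 0 := by
  refine (h.nrm_eq_zero 1 _).trans ⟨fun hx => congrFun (congrFun hx 0) 0, ?_⟩
  rintro rfl
  rfl

end IsOperatorSpace

/-- Ruan's axioms, with the direct sum axiom reduced to one inequality. -/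
theorem isOperatorSpace_of_directSum_le {N : MatrixNorms X}
    (eq_zero : ∀ (n : ℕ) (x : Matrix (Fin n) (Fin n) X), N.nrm n x = 0 → x = 0)
    (add_le : ∀ (n : ℕ) (x y : Matrix (Fin n) (Fin n) X),
      N.nrm n (x + y) ≤ N.nrm n x + N.nrm n y)
    (smul : ∀ (n : ℕ) (c : ℂ) (x : Matrix (Fin n) (Fin n) X),
      N.nrm n (c • x) = ‖c‖ * N.nrm n x)
    (complete : ∀ u : ℕ → X,
      (∀ ε > 0, ∃ k, ∀ m ≥ k, ∀ n ≥ k, N.one (u m - u n) < ε) →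
      ∃ x, ∀ ε > 0, ∃ k, ∀ n ≥ k, N.one (u n - x) < ε)
    (directSum_le : ∀ (m n : ℕ) (v : Matrix (Fin m) (Fin m) X) (w : Matrix (Fin n) (Fin n) X),
      N.nrm (m + n) (matDirectSum v w) ≤ max (N.nrm m v) (N.nrm n w))
    (sandwich_le : open scoped Matrix.Norms.L2Operator in
      ∀ (m n : ℕ) (α : Matrix (Fin n) (Fin m) ℂ) (v : Matrix (Fin m) (Fin m) X)
      (β : Matrix (Fin m) (Fin n) ℂ), N.nrm n (matSandwich α v β) ≤ ‖α‖ * N.nrm m v * ‖β‖) :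
    N.IsOperatorSpace := by
  have zero : ∀ n, N.nrm n 0 = 0 := fun n => by simpa using smul n 0 0
  have nonneg : ∀ n x, 0 ≤ N.nrm n x := fun n x => by
    have h1 := add_le n x (-x)
    have h2 := smul n (-1) x
    rw [neg_one_smul, norm_neg, norm_one, one_mul] at h2
    rw [add_neg_cancel, zero, h2] at h1
    linarith
  have sub : ∀ {m n : ℕ} {e : Fin n → Fin m}, Function.Injective e →
      ∀ v : Matrix (Fin m) (Fin m) X, N.nrm n (v.submatrix e e) ≤ N.nrm m v := by
    intro m n e he v
    have h1 := sandwich_le m n (selectionMatrix e).conjTranspose v (selectionMatrix e)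
    rw [matSandwich_selectionMatrix] at h1
    refine h1.trans ((mul_le_of_le_one_right (mul_nonneg ?_ (nonneg m v))
      (norm_selectionMatrix_le he)).trans
      (mul_le_of_le_one_left (nonneg m v) (norm_selectionMatrix_conjTranspose_le he)))
    open scoped Matrix.Norms.L2Operator in exact norm_nonneg _
  refine ⟨fun n x => ⟨eq_zero n x, ?_⟩, add_le, smul, complete, fun m n v w => ?_, sandwich_le⟩
  · rintro rfl
    exact zero n
  -- The reverse inequality is automatic: both summands are compressions of the direct sum.
  · refine le_antisymm (directSum_le m n v w) (max_le ?_ ?_)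
    · have := sub (Fin.castAdd_injective m n) (matDirectSum v w)
      rwa [matDirectSum_submatrix_castAdd] at this
    · have := sub (Fin.natAdd_injective n m) (matDirectSum v w)
      rwa [matDirectSum_submatrix_natAdd] at this

/-! ### Completeness in the norm of `M_1(X)` -/

namespace IsOperatorSpace

variable {N : MatrixNorms X}

/-- The norm of `M_1(X) = X`. -/
abbrev normedAddCommGroup (h : N.IsOperatorSpace) : NormedAddCommGroup X :=
  letI : Norm X := ⟨N.one⟩
  NormedAddCommGroup.ofCore (𝕜 := ℂ)
    { norm_nonneg := h.one_nonneg
      norm_smul := h.one_smul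
      norm_triangle := h.one_add_le
      norm_eq_zero_iff := fun _ => h.one_eq_zero }

theorem completeSpace_of_one {E : Type*} [NormedAddCommGroup E] [Module ℂ E] {N : MatrixNorms E}
    (h : N.IsOperatorSpace) (hone : ∀ x, N.one x = ‖x‖) :
    CompleteSpace E := by
  refine Metric.complete_of_cauchySeq_tendsto fun u hu => ?_
  obtain ⟨x, hx⟩ := h.complete u fun ε hε => by
    obtain ⟨k, hk⟩ := Metric.cauchySeq_iff.1 hu ε hε
    exact ⟨k, fun m hm n hn => by rw [hone, ← dist_eq_norm]; exact hk m hm n hn⟩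
  refine ⟨x, Metric.tendsto_atTop.2 fun ε hε => ?_⟩
  obtain ⟨k, hk⟩ := hx ε hε
  exact ⟨k, fun n hn => by rw [dist_eq_norm, ← hone]; exact hk n hn⟩

end IsOperatorSpace

/-- If the norm of `M_1(X)` is given by a norm of `X`, then completeness of `X` is the completeness
axiom of operator spaces. -/
theorem exists_limit_of_completeSpace {E : Type*} [NormedAddCommGroup E] [CompleteSpace E]
    {N : MatrixNorms E} (hN : ∀ x, N.one x = ‖x‖) (u : ℕ → E)
    (hu : ∀ ε > 0, ∃ k, ∀ m ≥ k, ∀ n ≥ k, N.one (u m - u n) < ε) :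
    ∃ x, ∀ ε > 0, ∃ k, ∀ n ≥ k, N.one (u n - x) < ε := by
  have hc : CauchySeq u := Metric.cauchySeq_iff.2 fun ε hε => by
    obtain ⟨k, hk⟩ := hu ε hε
    exact ⟨k, fun m hm n hn => by rw [dist_eq_norm, ← hN]; exact hk m hm n hn⟩
  obtain ⟨x, hx⟩ := cauchySeq_tendsto_of_complete hc
  refine ⟨x, fun ε hε => ?_⟩
  obtain ⟨k, hk⟩ := Metric.tendsto_atTop.1 hx ε hε
  exact ⟨k, fun n hn => by rw [hN, ← dist_eq_norm]; exact hk n hn⟩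

end MatrixNorms

/-- A normed group is complete if it is the image of a complete one by a bounded additive map along
which elements lift with control of the norm. -/
theorem completeSpace_of_bounded_lift {E F : Type*} [NormedAddCommGroup E] [CompleteSpace E]
    [NormedAddCommGroup F] (L : E →+ F) (D : ℝ) (hL : ∀ x, ‖L x‖ ≤ D * ‖x‖) (C : ℝ)
    (hlift : ∀ y, ∃ x, L x = y ∧ ‖x‖ ≤ C * ‖y‖) : CompleteSpace F := by
  -- An absolutely convergent series lifts term by term to an absolutely convergent series in `E`;
  -- the image of its sum is the required limit.
  refine NormedAddCommGroup.completeSpace_of_summable_imp_tendsto fun u hu => ?_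
  choose s hs hsC using hlift
  have h1 : Summable fun n => s (u n) :=
    Summable.of_norm_bounded (hu.mul_left C) fun n => hsC (u n)
  have h2 := (AddMonoidHomClass.continuous_of_bound L D hL).tendsto _ |>.comp
    h1.hasSum.tendsto_sum_nat
  refine ⟨_, h2.congr fun n => ?_⟩
  simp [hs]

theorem exists_matrix_map_eq {X Y : Type*} {L : X → Y} (hL : Function.Surjective L) {n : ℕ}
    (y : Matrix (Fin n) (Fin n) Y) : ∃ x : Matrix (Fin n) (Fin n) X, x.map L = y := by
  choose s hs using hL
  exact ⟨y.map s, by ext i j; simp [hs]⟩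

namespace MatrixNorms

variable {X Y Z K : Type*} [AddCommGroup X] [Module ℂ X] [AddCommGroup Y] [Module ℂ Y]
  [AddCommGroup Z] [Module ℂ Z] [AddCommGroup K] [Module ℂ K]

/-! ### Subspaces, direct sums and quotients of operator spaces -/

theorem matrix_map_add (L : X →ₗ[ℂ] Y) {n : ℕ} (x y : Matrix (Fin n) (Fin n) X) :
    (x + y).map L = x.map L + y.map L :=
  Matrix.map_add L (map_add L) x y

theorem matrix_map_smul (L : X →ₗ[ℂ] Y) {n : ℕ} (c : ℂ) (x : Matrix (Fin n) (Fin n) X) :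
    (c • x).map L = c • x.map L :=
  Matrix.map_smul L c (map_smul L c) x

theorem IsOperatorSpace.quotientAlong_le {N : MatrixNorms X} (h : N.IsOperatorSpace)
    (L : X →ₗ[ℂ] Y) {n : ℕ} {x : Matrix (Fin n) (Fin n) X} {y : Matrix (Fin n) (Fin n) Y}
    (hxy : x.map L = y) : (N.quotientAlong L).nrm n y ≤ N.nrm n x := by
  refine csInf_le ⟨0, ?_⟩ ⟨x, hxy, rfl⟩
  rintro r ⟨x, -, rfl⟩
  exact h.nrm_nonneg n x

theorem exists_lift_lt (N : MatrixNorms X) {L : X →ₗ[ℂ] Y}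
    (hL : Function.Surjective L) {n : ℕ} (y : Matrix (Fin n) (Fin n) Y) {r : ℝ}
    (hr : (N.quotientAlong L).nrm n y < r) :
    ∃ x : Matrix (Fin n) (Fin n) X, x.map L = y ∧ N.nrm n x < r := by
  obtain ⟨x, hx⟩ := exists_matrix_map_eq hL y
  obtain ⟨_, ⟨x, hxy, rfl⟩, hlt⟩ := exists_lt_of_csInf_lt
    (s := {r : ℝ | ∃ x : Matrix (Fin n) (Fin n) X, x.map L = y ∧ N.nrm n x = r}) ⟨_, x, hx, rfl⟩ hr
  exact ⟨x, hxy, hlt⟩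

theorem le_quotientAlong (N : MatrixNorms X) {L : X →ₗ[ℂ] Y}
    (hL : Function.Surjective L) {n : ℕ} (y : Matrix (Fin n) (Fin n) Y) {r : ℝ}
    (hr : ∀ x : Matrix (Fin n) (Fin n) X, x.map L = y → r ≤ N.nrm n x) :
    r ≤ (N.quotientAlong L).nrm n y := by
  refine le_of_forall_gt fun s hs => ?_
  obtain ⟨x, hx, hlt⟩ := N.exists_lift_lt hL y hs
  exact (hr x hx).trans_lt hlt

theorem IsOperatorSpace.quotientAlong_nonneg {N : MatrixNorms X} (h : N.IsOperatorSpace)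
    (L : X →ₗ[ℂ] Y) (n : ℕ) (y : Matrix (Fin n) (Fin n) Y) :
    0 ≤ (N.quotientAlong L).nrm n y := by
  refine Real.sInf_nonneg ?_
  rintro r ⟨x, -, rfl⟩
  exact h.nrm_nonneg n x

/-- Two lifts of `y` differ by a matrix over the kernel. If lifts of arbitrarily small norm exist,
every entry of a fixed lift is a limit of kernel elements, hence lies in the kernel. -/
theorem IsOperatorSpace.quotientAlong_eq_zero {N : MatrixNorms X} (h : N.IsOperatorSpace)
    {L : X →ₗ[ℂ] Y} (hL : Function.Surjective L) (hker : N.IsClosedSubspace (LinearMap.ker L))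
    {n : ℕ} {y : Matrix (Fin n) (Fin n) Y} (hy : (N.quotientAlong L).nrm n y = 0) : y = 0 := by
  obtain ⟨x, rfl⟩ := exists_matrix_map_eq hL y
  ext i j
  refine hker (x i j) fun ε hε => ?_
  obtain ⟨x', hx', hlt⟩ := N.exists_lift_lt hL _ (hy.trans_lt hε)
  refine ⟨x i j - x' i j, ?_, ?_⟩
  · have := congrFun (congrFun hx' i) j
    simp only [Matrix.map_apply] at this
    simp [this]
  · rw [sub_sub_cancel]
    exact (h.one_apply_le x' i j).trans_lt hlt

theorem IsOperatorSpace.quotientAlong {N : MatrixNorms X} (h : N.IsOperatorSpace)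
    {L : X →ₗ[ℂ] Y} (hL : Function.Surjective L) (hker : N.IsClosedSubspace (LinearMap.ker L)) :
    (N.quotientAlong L).IsOperatorSpace := by
  have eq_zero : ∀ (n : ℕ) (x : Matrix (Fin n) (Fin n) Y),
      (N.quotientAlong L).nrm n x = 0 → x = 0 := fun n x => h.quotientAlong_eq_zero hL hker
  have add_le : ∀ (n : ℕ) (x y : Matrix (Fin n) (Fin n) Y), (N.quotientAlong L).nrm n (x + y) ≤
      (N.quotientAlong L).nrm n x + (N.quotientAlong L).nrm n y := by
    intro n y y'
    refine le_of_forall_pos_le_add fun ε hε => ?_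
    obtain ⟨x, rfl, hx⟩ := N.exists_lift_lt hL y (lt_add_of_pos_right _ (half_pos hε))
    obtain ⟨x', rfl, hx'⟩ := N.exists_lift_lt hL y' (lt_add_of_pos_right _ (half_pos hε))
    have h1 := h.quotientAlong_le L (matrix_map_add L x x')
    have h2 := h.nrm_add_le n x x'
    linarith
  have smul_le : ∀ (n : ℕ) (c : ℂ) (x : Matrix (Fin n) (Fin n) Y),
      (N.quotientAlong L).nrm n (c • x) ≤ ‖c‖ * (N.quotientAlong L).nrm n x := by
    intro n c y
    rcases eq_or_ne c 0 with rfl | hc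
    · have h1 := h.quotientAlong_le L (x := 0) (y := (0 : ℂ) • y) (by ext; simp)
      simpa [h.nrm_zero] using h1
    · rw [← div_le_iff₀' (norm_pos_iff.2 hc)]
      refine N.le_quotientAlong hL y fun x hx => ?_
      rw [div_le_iff₀' (norm_pos_iff.2 hc), ← h.nrm_smul]
      exact h.quotientAlong_le L (by rw [matrix_map_smul, hx])
  have smul : ∀ (n : ℕ) (c : ℂ) (x : Matrix (Fin n) (Fin n) Y),
      (N.quotientAlong L).nrm n (c • x) = ‖c‖ * (N.quotientAlong L).nrm n x := by
    intro n c y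
    refine le_antisymm (smul_le n c y) ?_
    rcases eq_or_ne c 0 with rfl | hc
    · simpa using h.quotientAlong_nonneg L n _
    · have h1 := smul_le n c⁻¹ (c • y)
      rw [inv_smul_smul₀ hc, norm_inv] at h1
      rwa [le_inv_mul_iff₀ (norm_pos_iff.2 hc)] at h1
  refine isOperatorSpace_of_directSum_le eq_zero add_le smul ?_ ?_ ?_
  · let _ := h.normedAddCommGroup
    have := h.completeSpace_of_one fun _ => rfl
    let _ : NormedAddCommGroup Y :=
      let _ : Norm Y := ⟨(N.quotientAlong L).one⟩
      NormedAddCommGroup.ofCore (𝕜 := ℂ)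
        { norm_nonneg := fun y => h.quotientAlong_nonneg L 1 _
          norm_smul := fun c y => smul 1 c _
          norm_triangle := fun y y' => add_le 1 _ _
          norm_eq_zero_iff := fun y => by
            refine ⟨fun hy => congrFun (congrFun (eq_zero 1 _ hy) 0) 0, ?_⟩
            rintro rfl
            exact (congrArg _ (zero_smul ℂ _).symm).trans ((smul 1 0 0).trans (by simp)) }
    have hY : ∀ y : Y, (N.quotientAlong L).one y = ‖y‖ := fun _ => rfl
    have hX : ∀ x : X, N.one x = ‖x‖ := fun _ => rfl
    have : CompleteSpace Y := by
      refine completeSpace_of_bounded_lift (L : X →+ Y) 1 (fun x => ?_) 2 fun y => ?_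
      · rw [one_mul]
        exact h.quotientAlong_le L (by ext; rfl)
      -- The infimum need not be attained; the factor 2 leaves room for a lift, except at `y = 0`.
      · rcases eq_or_ne y 0 with rfl | hy
        · exact ⟨0, map_zero _, by simp⟩
        · obtain ⟨x, hx, hlt⟩ := N.exists_lift_lt hL (fun _ _ : Fin 1 => y)
            (show ‖y‖ < 2 * ‖y‖ by linarith [norm_pos_iff.2 hy])
          refine ⟨x 0 0, congrFun (congrFun hx 0) 0, ?_⟩
          rw [← hX]
          exact (h.one_apply_le x 0 0).trans hlt.le
    exact exists_limit_of_completeSpace hY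
  · intro m n v w
    refine le_of_forall_pos_le_add fun ε hε => ?_
    obtain ⟨x, rfl, hx⟩ := N.exists_lift_lt hL v (lt_add_of_pos_right _ hε)
    obtain ⟨x', rfl, hx'⟩ := N.exists_lift_lt hL w (lt_add_of_pos_right _ hε)
    refine (h.quotientAlong_le L (matDirectSum_map L x x')).trans ?_
    rw [h.nrm_directSum, max_add]
    exact max_le_max hx.le hx'.le
  · intro m n α v β
    open scoped Matrix.Norms.L2Operator in
    refine le_of_forall_pos_le_add fun ε hε => ?_
    have hC : 0 ≤ ‖α‖ * ‖β‖ := by positivity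
    -- The `+ 1` keeps the denominator positive when `α` or `β` vanishes.
    have hC' : 0 < ‖α‖ * ‖β‖ + 1 := by positivity
    obtain ⟨x, rfl, hx⟩ := N.exists_lift_lt hL v (lt_add_of_pos_right _ (div_pos hε hC'))
    refine (h.quotientAlong_le L (matSandwich_map L α x β)).trans
      ((h.nrm_sandwich_le m n α x β).trans ?_)
    have h1 : (‖α‖ * ‖β‖) * (ε / (‖α‖ * ‖β‖ + 1)) ≤ ε := by
      rw [mul_div_assoc', div_le_iff₀ hC']
      nlinarith
    have h2 := mul_le_mul_of_nonneg_left hx.le hC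
    linarith

theorem IsOperatorSpace.quotient {N : MatrixNorms X} (h : N.IsOperatorSpace)
    {W : Submodule ℂ X} (hW : N.IsClosedSubspace W) : (N.quotient W).IsOperatorSpace :=
  h.quotientAlong W.mkQ_surjective (by rwa [Submodule.ker_mkQ])

theorem isClosedSubspace_sInf (N : MatrixNorms X) {S : Set (Submodule ℂ X)}
    (hS : ∀ W ∈ S, N.IsClosedSubspace W) : N.IsClosedSubspace (sInf S) := by
  intro x hx
  rw [Submodule.mem_sInf]
  intro W hW
  refine hS W hW x fun ε hε => ?_
  obtain ⟨w, hw, h⟩ := hx ε hε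
  exact ⟨w, Submodule.mem_sInf.1 hw W hW, h⟩

theorem isClosedSubspace_closure (N : MatrixNorms X) (W : Submodule ℂ X) :
    N.IsClosedSubspace (N.closure W) :=
  N.isClosedSubspace_sInf fun _ h => h.2

theorem closure_eq_self (N : MatrixNorms X) {W : Submodule ℂ X} (hW : N.IsClosedSubspace W) :
    N.closure W = W :=
  le_antisymm (sInf_le ⟨le_rfl, hW⟩) (le_sInf fun _ h => h.1)

/-- The kernel of a linear map into a normed space that is bounded for the norm of `M_1(X)` is
closed. -/
theorem IsOperatorSpace.isClosedSubspace_ker {N : MatrixNorms X} (h : N.IsOperatorSpace) {E : Type*}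
    [NormedAddCommGroup E] [Module ℂ E] (L : X →ₗ[ℂ] E) (C : ℝ) (hL : ∀ x, ‖L x‖ ≤ C * N.one x) :
    N.IsClosedSubspace (LinearMap.ker L) := by
  intro x hx
  rw [LinearMap.mem_ker, ← norm_le_zero_iff]
  refine le_of_forall_pos_le_add fun ε hε => ?_
  obtain ⟨w, hw, hlt⟩ := hx (ε / (|C| + 1)) (by positivity)
  have h1 := hL (x - w)
  rw [map_sub, LinearMap.mem_ker.1 hw, sub_zero] at h1
  rw [lt_div_iff₀ (by positivity)] at hlt
  nlinarith [le_abs_self C, abs_nonneg C, h.one_nonneg (x - w)]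

/-- Norms pulled back from an operator space along an injective linear map with closed range are
those of an operator space. -/
theorem IsOperatorSpace.comap {N : MatrixNorms Y} (h : N.IsOperatorSpace) {N' : MatrixNorms X}
    (L : X →ₗ[ℂ] Y) (hL : Function.Injective L)
    (hrange : N.IsClosedSubspace (LinearMap.range L))
    (hN' : ∀ (n : ℕ) (x : Matrix (Fin n) (Fin n) X), N'.nrm n x = N.nrm n (x.map L)) :
    N'.IsOperatorSpace := by
  have one : ∀ x, N'.one x = N.one (L x) := fun x => hN' 1 _
  refine isOperatorSpace_of_directSum_le (fun n x hx => ?_) (fun n x y => ?_) (fun n c x => ?_)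
    (fun u hu => ?_) (fun m n v w => ?_) (fun m n α v β => ?_)
  · rw [hN'] at hx
    have := (h.nrm_eq_zero n _).1 hx
    ext i j
    exact hL ((congrFun (congrFun this i) j).trans (map_zero L).symm)
  · simp only [hN', matrix_map_add]
    exact h.nrm_add_le n _ _
  · simp only [hN', matrix_map_smul]
    exact h.nrm_smul n c _
  · simp only [one, map_sub] at hu ⊢
    obtain ⟨x, hx⟩ := h.complete (fun n => L (u n)) hu
    obtain ⟨x, rfl⟩ := hrange x fun ε hε => by
      obtain ⟨k, hk⟩ := hx ε hε
      refine ⟨L (u k), ⟨u k, rfl⟩, ?_⟩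
      have h1 := h.one_smul (-1) (L (u k) - x)
      rw [neg_one_smul, neg_sub] at h1
      simpa [h1] using hk k le_rfl
    exact ⟨x, hx⟩
  · simp only [hN', matDirectSum_map]
    exact (h.nrm_directSum m n _ _).le
  · simp only [hN', matSandwich_map]
    exact h.nrm_sandwich_le m n _ _ _

theorem IsOperatorSpace.restrict {N : MatrixNorms X} (h : N.IsOperatorSpace)
    {W : Submodule ℂ X} (hW : N.IsClosedSubspace W) : (N.restrict W).IsOperatorSpace :=
  h.comap W.subtype W.subtype_injective (by rwa [Submodule.range_subtype]) fun _ _ => rfl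

theorem IsOperatorSpace.prod {N : MatrixNorms X} {N' : MatrixNorms K} (h : N.IsOperatorSpace)
    (h' : N'.IsOperatorSpace) : (N.prod N').IsOperatorSpace := by
  refine isOperatorSpace_of_directSum_le (fun n x hx => ?_) (fun n x y => ?_) (fun n c x => ?_)
    (fun u hu => ?_) (fun m n v w => ?_) (fun m n α v β => ?_)
  · have h0 := h.nrm_nonneg n (x.map Prod.fst)
    have h0' := h'.nrm_nonneg n (x.map Prod.snd)
    have h1 : max _ _ = (0 : ℝ) := hx
    have h2 := (h.nrm_eq_zero n _).1 (le_antisymm ((le_max_left _ _).trans h1.le) h0)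
    have h3 := (h'.nrm_eq_zero n _).1 (le_antisymm ((le_max_right _ _).trans h1.le) h0')
    ext i j
    · exact congrFun (congrFun h2 i) j
    · exact congrFun (congrFun h3 i) j
  · exact max_le ((h.nrm_add_le n _ _).trans (add_le_add (le_max_left _ _) (le_max_left _ _)))
      ((h'.nrm_add_le n _ _).trans (add_le_add (le_max_right _ _) (le_max_right _ _)))
  · refine (congrArg₂ max (h.nrm_smul n c _) (h'.nrm_smul n c _)).trans ?_
    exact (mul_max_of_nonneg _ _ (norm_nonneg c)).symm
  · obtain ⟨x, hx⟩ := h.complete (fun n => (u n).1) fun ε hε => by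
      obtain ⟨k, hk⟩ := hu ε hε
      exact ⟨k, fun m hm n hn => (le_max_left _ _).trans_lt (hk m hm n hn)⟩
    obtain ⟨y, hy⟩ := h'.complete (fun n => (u n).2) fun ε hε => by
      obtain ⟨k, hk⟩ := hu ε hε
      exact ⟨k, fun m hm n hn => (le_max_right _ _).trans_lt (hk m hm n hn)⟩
    refine ⟨(x, y), fun ε hε => ?_⟩
    obtain ⟨k, hk⟩ := hx ε hε
    obtain ⟨l, hl⟩ := hy ε hε
    exact ⟨max k l, fun n hn =>
      max_lt (hk n ((le_max_left _ _).trans hn)) (hl n ((le_max_right _ _).trans hn))⟩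
  · have h1 := matDirectSum_map (LinearMap.fst ℂ X K) v w
    have h2 := matDirectSum_map (LinearMap.snd ℂ X K) v w
    refine max_le ?_ ?_
    · exact ((congrArg (N.nrm (m + n)) h1).trans (h.nrm_directSum m n _ _)).trans_le
        (max_le_max (le_max_left _ _) (le_max_left _ _))
    · exact ((congrArg (N'.nrm (m + n)) h2).trans (h'.nrm_directSum m n _ _)).trans_le
        (max_le_max (le_max_right _ _) (le_max_right _ _))
  · have h1 := matSandwich_map (LinearMap.fst ℂ X K) α v β
    have h2 := matSandwich_map (LinearMap.snd ℂ X K) α v β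
    open scoped Matrix.Norms.L2Operator in
    refine max_le ?_ ?_
    · refine ((congrArg (N.nrm n) h1).trans_le (h.nrm_sandwich_le m n _ _ _)).trans ?_
      gcongr
      exact le_max_left _ _
    · refine ((congrArg (N'.nrm n) h2).trans_le (h'.nrm_sandwich_le m n _ _ _)).trans ?_
      gcongr
      exact le_max_right _ _

end MatrixNorms

/-! ### Extension sequences and pushouts -/

section

variable {X X' Y Z K : Type*} [AddCommGroup X] [Module ℂ X] [AddCommGroup Y] [Module ℂ Y]
  [AddCommGroup Z] [Module ℂ Z] [AddCommGroup K] [Module ℂ K] [AddCommGroup X'] [Module ℂ X']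

/-- A completely bounded map has a nonnegative bound. -/
theorem IsCompletelyBounded.exists_nonneg {NX : MatrixNorms X} {NY : MatrixNorms Y}
    {T : X →ₗ[ℂ] Y} (h : IsCompletelyBounded NX NY T) (hX : NX.IsOperatorSpace) :
    ∃ C : ℝ, 0 ≤ C ∧ ∀ (n : ℕ) (x : Matrix (Fin n) (Fin n) X),
      NY.nrm n (x.map T) ≤ C * NX.nrm n x := by
  obtain ⟨C, hC⟩ := h
  exact ⟨max C 0, le_max_right _ _, fun n x => (hC n x).trans
    (mul_le_mul_of_nonneg_right (le_max_left _ _) (hX.nrm_nonneg n x))⟩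

theorem IsCompletelyBounded.comp {NX : MatrixNorms X} {NY : MatrixNorms Y} {NZ : MatrixNorms Z}
    {S : Y →ₗ[ℂ] Z} {T : X →ₗ[ℂ] Y} (hY : NY.IsOperatorSpace) (hS : IsCompletelyBounded NY NZ S)
    (hT : IsCompletelyBounded NX NY T) : IsCompletelyBounded NX NZ (S ∘ₗ T) := by
  obtain ⟨C, hC0, hC⟩ := hS.exists_nonneg hY
  obtain ⟨D, hD⟩ := hT
  refine ⟨C * D, fun n x => ?_⟩
  rw [mul_assoc]
  exact (hC n (x.map T)).trans (mul_le_mul_of_nonneg_left (hD n x) hC0)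

/-- A short exact sequence of operator spaces with completely bounded maps is an extension sequence
if the left map is completely bounded below and matrices lift along the right map with uniform
control of the norms. -/
theorem IsExtensionSequence.of_bounds {NY : MatrixNorms Y} {NX : MatrixNorms X}
    {NZ : MatrixNorms Z} {i : Y →ₗ[ℂ] X} {q : X →ₗ[ℂ] Z} (hY : NY.IsOperatorSpace)
    (hX : NX.IsOperatorSpace) (hZ : NZ.IsOperatorSpace) (injective : Function.Injective i)
    (exact : Function.Exact i q) (surjective : Function.Surjective q)
    (left_cb : IsCompletelyBounded NY NX i) (right_cb : IsCompletelyBounded NX NZ q)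
    (left_below : ∃ C : ℝ, ∀ (n : ℕ) (y : Matrix (Fin n) (Fin n) Y),
      NY.nrm n y ≤ C * NX.nrm n (y.map i))
    (right_lift : ∃ C : ℝ, ∀ (n : ℕ) (z : Matrix (Fin n) (Fin n) Z), ∀ ε > 0,
      ∃ x : Matrix (Fin n) (Fin n) X, x.map q = z ∧ NX.nrm n x ≤ C * NZ.nrm n z + ε) :
    IsExtensionSequence NY NX NZ i q := by
  refine ⟨hY, hX, hZ, injective, exact, surjective, left_cb, right_cb, ?_, ?_⟩
  · refine ⟨LinearEquiv.ofInjective i injective, LinearMap.ext fun y => rfl, left_cb, ?_⟩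
    obtain ⟨C, hC⟩ := left_below
    refine ⟨C, fun n x => ?_⟩
    refine (hC n _).trans_eq (congrArg (fun a => C * NX.nrm n a) ?_)
    ext k l
    exact congrArg Subtype.val ((LinearEquiv.ofInjective i injective).apply_symm_apply (x k l))
  · refine ⟨q.quotKerEquivOfSurjective surjective, LinearMap.ext fun x => rfl, ?_, ?_⟩
    · obtain ⟨C, hC0, hC⟩ := right_cb.exists_nonneg hX
      refine ⟨C, fun n x => ?_⟩
      refine le_of_forall_pos_le_add fun ε hε => ?_
      obtain ⟨x, rfl, hx⟩ := NX.exists_lift_lt (LinearMap.ker q).mkQ_surjective x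
        (lt_add_of_pos_right _ (div_pos hε (by positivity : 0 < C + 1)))
      have h1 : C * (ε / (C + 1)) ≤ ε := by
        rw [mul_div_assoc', div_le_iff₀ (by positivity)]
        nlinarith
      have h2 := (hC n x).trans (mul_le_mul_of_nonneg_left hx.le hC0)
      rw [mul_add] at h2
      exact h2.trans (add_le_add_right h1 _)
    · obtain ⟨C, hC⟩ := right_lift
      refine ⟨C, fun n z => le_of_forall_pos_le_add fun ε hε => ?_⟩
      obtain ⟨x, rfl, hx⟩ := hC n z ε hε
      refine (hX.quotientAlong_le (LinearMap.ker q).mkQ (x := x) ?_).trans hx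
      ext k l
      exact ((q.quotKerEquivOfSurjective surjective).symm_apply_apply _).symm

/-- The kernel of a completely quotient map and the quotient map form an extension sequence. -/
theorem IsExtensionSequence.subtype_ker {N : MatrixNorms X} (hN : N.IsOperatorSpace)
    {L : X →ₗ[ℂ] Y} (hL : Function.Surjective L) {W : Submodule ℂ X} (hW : LinearMap.ker L = W)
    (hWc : N.IsClosedSubspace W) :
    IsExtensionSequence (N.restrict W) N (N.quotientAlong L) W.subtype L := by
  subst hW
  refine .of_bounds (hN.restrict hWc) hN (hN.quotientAlong hL hWc) (Submodule.subtype_injective _)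
    ?_ hL ⟨1, fun n x => ?_⟩ ⟨1, fun n x => ?_⟩ ⟨1, fun n x => ?_⟩ ⟨1, fun n z ε hε => ?_⟩
  · rw [LinearMap.exact_iff, Submodule.range_subtype]
  · rw [one_mul]; rfl
  · rw [one_mul]; exact hN.quotientAlong_le L rfl
  · rw [one_mul]; rfl
  · obtain ⟨x, hx, hlt⟩ := N.exists_lift_lt hL z (lt_add_of_pos_right _ hε)
    exact ⟨x, hx, by rw [one_mul]; exact hlt.le⟩

/-- Together with `right_lift`, this unpacks the two isomorphism conditions into the estimates from
which `of_bounds` rebuilds them; the later arguments use only these estimates. -/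
theorem IsExtensionSequence.left_below {NY : MatrixNorms Y} {NX : MatrixNorms X}
    {NZ : MatrixNorms Z} {i : Y →ₗ[ℂ] X} {q : X →ₗ[ℂ] Z} (h : IsExtensionSequence NY NX NZ i q) :
    ∃ C : ℝ, 0 ≤ C ∧ ∀ (n : ℕ) (y : Matrix (Fin n) (Fin n) Y),
      NY.nrm n y ≤ C * NX.nrm n (y.map i) := by
  obtain ⟨e, he, -, C, hC⟩ := h.left_iso
  refine ⟨max C 0, le_max_right _ _, fun n y => ?_⟩
  refine le_trans ?_ (mul_le_mul_of_nonneg_right (le_max_left C 0)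
    (h.mid_operatorSpace.nrm_nonneg n _))
  have h1 := hC n (y.map e)
  have h2 : (y.map e).map (e.symm : _ →ₗ[ℂ] Y) = y := by ext; simp
  rw [h2] at h1
  refine h1.trans_eq (congrArg (fun a => C * NX.nrm n a) ?_)
  ext k l
  exact congrArg Subtype.val (LinearMap.congr_fun he (y k l))

/-- The inverse of the induced isomorphism bounds the quotient norm, which is an infimum over lifts;
`ε` is needed since it may not be attained. -/
theorem IsExtensionSequence.right_lift {NY : MatrixNorms Y} {NX : MatrixNorms X}
    {NZ : MatrixNorms Z} {i : Y →ₗ[ℂ] X} {q : X →ₗ[ℂ] Z} (h : IsExtensionSequence NY NX NZ i q) :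
    ∃ C : ℝ, ∀ (n : ℕ) (z : Matrix (Fin n) (Fin n) Z), ∀ ε > 0,
      ∃ x : Matrix (Fin n) (Fin n) X, x.map q = z ∧ NX.nrm n x ≤ C * NZ.nrm n z + ε := by
  obtain ⟨e, he, -, C, hC⟩ := h.right_iso
  refine ⟨C, fun n z ε hε => ?_⟩
  obtain ⟨x, hx, hlt⟩ := NX.exists_lift_lt (LinearMap.ker q).mkQ_surjective _
    ((hC n z).trans_lt (lt_add_of_pos_right _ hε))
  refine ⟨x, ?_, hlt.le⟩
  ext k l
  have h1 : (LinearMap.ker q).mkQ (x k l) = e.symm (z k l) := congrFun (congrFun hx k) l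
  have h2 := LinearMap.congr_fun he ((LinearMap.ker q).mkQ (x k l))
  rw [h1] at h2
  have h3 : z k l = (LinearMap.ker q).liftQ q le_rfl (e.symm (z k l)) := by simpa using h2
  rw [h3, ← h1]
  rfl

/-- Extension sequences can be transported along complete isomorphisms of the middle space. -/
theorem IsExtensionSequence.of_completeIso {NY : MatrixNorms Y} {NX : MatrixNorms X}
    {NX' : MatrixNorms X'} {NZ : MatrixNorms Z} {i : Y →ₗ[ℂ] X} {q : X →ₗ[ℂ] Z} {j : Y →ₗ[ℂ] X'}
    {p : X' →ₗ[ℂ] Z} (h : IsExtensionSequence NY NX NZ i q) (hX' : NX'.IsOperatorSpace)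
    {T : X →ₗ[ℂ] X'} (hT : IsCompleteIso NX NX' T) (hj : T ∘ₗ i = j) (hp : p ∘ₗ T = q) :
    IsExtensionSequence NY NX' NZ j p := by
  obtain ⟨e, rfl, he, he'⟩ := hT
  have hq : p = q ∘ₗ (e.symm : X' →ₗ[ℂ] X) := by
    rw [← hp, LinearMap.comp_assoc, LinearEquiv.comp_symm, LinearMap.comp_id]
  subst hj
  have hX := h.mid_operatorSpace
  refine .of_bounds h.left_operatorSpace hX' h.right_operatorSpace
    (e.injective.comp h.injective) (fun x => ?_) (fun z => ?_) (he.comp hX h.left_cb)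
    (hq ▸ h.right_cb.comp hX he') ?_ ?_
  · rw [hq, LinearMap.comp_apply]
    refine (h.exact _).trans ⟨?_, ?_⟩
    · rintro ⟨y, hy⟩
      exact ⟨y, by simp [hy]⟩
    · rintro ⟨y, rfl⟩
      exact ⟨y, by simp⟩
  · obtain ⟨x, rfl⟩ := h.surjective z
    exact ⟨e x, LinearMap.congr_fun hp x⟩
  · obtain ⟨C, hC0, hC⟩ := h.left_below
    obtain ⟨D, hD⟩ := he'
    refine ⟨C * D, fun n y => ?_⟩
    rw [mul_assoc]
    refine (hC n y).trans (mul_le_mul_of_nonneg_left (le_trans (le_of_eq ?_) (hD n _)) hC0)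
    congr 1
    ext k l
    simp
  · obtain ⟨C, hC⟩ := h.right_lift
    obtain ⟨D, hD0, hD⟩ := he.exists_nonneg hX
    refine ⟨D * C, fun n z ε hε => ?_⟩
    obtain ⟨x, rfl, hx⟩ := hC n z (ε / (D + 1)) (by positivity)
    refine ⟨x.map e, ?_, ?_⟩
    · ext k l
      exact LinearMap.congr_fun hp (x k l)
    · have h1 : D * (ε / (D + 1)) ≤ ε := by
        rw [mul_div_assoc', div_le_iff₀ (by positivity)]
        nlinarith
      have h2 := (hD n x).trans (mul_le_mul_of_nonneg_left hx hD0)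
      rw [mul_add, ← mul_assoc] at h2
      exact h2.trans (add_le_add_right h1 _)

/-! ### Pushouts of extension sequences -/

section Pushout

variable {NY : MatrixNorms Y} {NX : MatrixNorms X} {NZ : MatrixNorms Z} {NK : MatrixNorms K}
  {A : Y →ₗ[ℂ] X} {Q : X →ₗ[ℂ] Z} {B : Y →ₗ[ℂ] K}

/-- For an extension sequence with left map `A`, the subspace `{(A y, -B y)}` is closed. -/
theorem IsExtensionSequence.pushoutKernel_eq (h : IsExtensionSequence NY NX NZ A Q)
    (hK : NK.IsOperatorSpace) (hB : IsCompletelyBounded NY NK B) :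
    pushoutKernel NX NK A B = LinearMap.range (A.prod (-B)) := by
  refine MatrixNorms.closure_eq_self _ ?_
  rintro ⟨x, k⟩ hx
  have hX := h.mid_operatorSpace
  have hZ := h.right_operatorSpace
  obtain ⟨C, hC0, hC⟩ := h.right_cb.exists_nonneg hX
  -- `x` is a limit of elements `A y`, all killed by the bounded map `Q`.
  have hQ : Q x = 0 := by
    refine hZ.one_eq_zero.1 (le_antisymm ?_ (hZ.one_nonneg _))
    refine le_of_forall_pos_le_add fun ε hε => ?_
    obtain ⟨_, ⟨y, rfl⟩, hy⟩ := hx (ε / (C + 1)) (by positivity)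
    have h1 : NX.one (x - A y) < _ := (le_max_left _ _).trans_lt hy
    have h2 : NZ.one (Q (x - A y)) ≤ C * NX.one (x - A y) := hC 1 _
    rw [map_sub, h.exact.apply_apply_eq_zero, sub_zero] at h2
    rw [lt_div_iff₀ (by positivity)] at h1
    nlinarith [hX.one_nonneg (x - A y)]
  obtain ⟨y', rfl⟩ := (h.exact x).1 hQ
  obtain ⟨D, hD0, hD⟩ := hB.exists_nonneg h.left_operatorSpace
  obtain ⟨E, hE0, hE⟩ := h.left_below
  -- As `A` is bounded below, `A y` close to `A y'` forces `y` close to `y'`; then `-B y` is close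
  -- to both `-B y'` and `k`. The threshold `ε / (D * E + 1)` pays for both errors.
  have hk : k + B y' = 0 := by
    refine hK.one_eq_zero.1 (le_antisymm ?_ (hK.one_nonneg _))
    refine le_of_forall_pos_le_add fun ε hε => ?_
    obtain ⟨_, ⟨y, rfl⟩, hy⟩ := hx (ε / (D * E + 1)) (by positivity)
    have h1 : NX.one (A y' - A y) < _ := (le_max_left _ _).trans_lt hy
    have h2 : NK.one (k - -B y) < _ := (le_max_right _ _).trans_lt hy
    have h3 : NK.one (B (y' - y)) ≤ D * NY.one (y' - y) := hD 1 _
    have h4 : NY.one (y' - y) ≤ E * NX.one (A (y' - y)) := hE 1 _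
    have h5 := hK.one_add_le (k - -B y) (B (y' - y))
    rw [map_sub B, sub_neg_eq_add, add_assoc, add_sub_cancel, ← map_sub B] at h5
    rw [map_sub A] at h4
    rw [sub_neg_eq_add] at h2
    have h6 := h3.trans (mul_le_mul_of_nonneg_left h4 hD0)
    have h7 := mul_le_mul_of_nonneg_left h1.le (mul_nonneg hD0 hE0)
    have h8 : (D * E) * (ε / (D * E + 1)) + ε / (D * E + 1) = ε := by field_simp
    linarith
  exact ⟨y', Prod.ext rfl (neg_eq_of_add_eq_zero_left hk)⟩

theorem pushoutMk_surjective (NX : MatrixNorms X) (NK : MatrixNorms K) (A : Y →ₗ[ℂ] X)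
    (B : Y →ₗ[ℂ] K) : Function.Surjective (pushoutMk NX NK A B) :=
  (pushoutKernel NX NK A B).mkQ_surjective

theorem IsExtensionSequence.pushoutMk_eq_zero_iff (h : IsExtensionSequence NY NX NZ A Q)
    (hK : NK.IsOperatorSpace) (hB : IsCompletelyBounded NY NK B) (v : X × K) :
    pushoutMk NX NK A B v = 0 ↔ ∃ y, A y = v.1 ∧ -B y = v.2 := by
  refine (Submodule.Quotient.mk_eq_zero _).trans ?_
  rw [h.pushoutKernel_eq hK hB]
  exact exists_congr fun y => Prod.ext_iff

/-- A linear map on `X × K` that vanishes on all `(A y, -B y)` factors through the pushout. -/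
theorem IsExtensionSequence.exists_pushout_lift (h : IsExtensionSequence NY NX NZ A Q)
    (hK : NK.IsOperatorSpace) (hB : IsCompletelyBounded NY NK B) (S : X × K →ₗ[ℂ] X')
    (hS : ∀ y, S (A y, -B y) = 0) :
    ∃ T : Pushout NX NK A B →ₗ[ℂ] X', ∀ v, T (pushoutMk NX NK A B v) = S v := by
  refine ⟨(pushoutKernel NX NK A B).liftQ S ?_, fun v => rfl⟩
  rw [h.pushoutKernel_eq hK hB]
  rintro _ ⟨y, rfl⟩
  exact hS y

theorem MatrixNorms.IsOperatorSpace.pushout (hX : NX.IsOperatorSpace) (hK : NK.IsOperatorSpace) :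
    (pushoutNorms NX NK A B).IsOperatorSpace :=
  (hX.prod hK).quotient (MatrixNorms.isClosedSubspace_closure _ _)

theorem pushoutNorms_le (hX : NX.IsOperatorSpace) (hK : NK.IsOperatorSpace) {n : ℕ}
    (v : Matrix (Fin n) (Fin n) (X × K)) :
    (pushoutNorms NX NK A B).nrm n (v.map (pushoutMk NX NK A B)) ≤
      max (NX.nrm n (v.map Prod.fst)) (NK.nrm n (v.map Prod.snd)) :=
  (hX.prod hK).quotientAlong_le _ rfl

theorem exists_pushout_rep_lt {n : ℕ} (w : Matrix (Fin n) (Fin n) (Pushout NX NK A B)) {r : ℝ}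
    (hr : (pushoutNorms NX NK A B).nrm n w < r) :
    ∃ v : Matrix (Fin n) (Fin n) (X × K), v.map (pushoutMk NX NK A B) = w ∧
      NX.nrm n (v.map Prod.fst) < r ∧ NK.nrm n (v.map Prod.snd) < r := by
  obtain ⟨v, hv, hlt⟩ := (NX.prod NK).exists_lift_lt
    (pushoutKernel NX NK A B).mkQ_surjective w hr
  exact ⟨v, hv, (le_max_left _ _).trans_lt hlt, (le_max_right _ _).trans_lt hlt⟩

/-- The pushout of an extension sequence along a completely bounded map is an extension
sequence. -/
theorem IsExtensionSequence.pushout (h : IsExtensionSequence NY NX NZ A Q)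
    (hK : NK.IsOperatorSpace) (hB : IsCompletelyBounded NY NK B)
    {q : Pushout NX NK A B →ₗ[ℂ] Z} (hq : ∀ x k, q (pushoutMk NX NK A B (x, k)) = Q x) :
    IsExtensionSequence NK (pushoutNorms NX NK A B) NZ (pushoutInr NX NK A B) q := by
  have hX := h.mid_operatorSpace
  obtain ⟨C, hC0, hC⟩ := h.left_below
  obtain ⟨D, hD0, hD⟩ := hB.exists_nonneg h.left_operatorSpace
  -- If `(0, k) ≡ (v₁, v₂)` modulo `Δ`, then entrywise `v₁ = A y` and `k = B y + v₂`. So `‖y‖ ≤ C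
  -- ‖v₁‖` and `‖k‖ ≤ D C ‖v₁‖ + ‖v₂‖`.
  have below : ∀ (n : ℕ) (k : Matrix (Fin n) (Fin n) K),
      NK.nrm n k ≤ (1 + D * C) * (pushoutNorms NX NK A B).nrm n (k.map (pushoutInr NX NK A B)) := by
    intro n k
    rw [← div_le_iff₀' (by positivity)]
    refine le_of_forall_gt fun r hr => ?_
    obtain ⟨v, hv, hlt, hlt'⟩ := exists_pushout_rep_lt _ hr
    have hy : ∀ a b, ∃ y, A y = (v a b).1 ∧ B y = k a b - (v a b).2 := fun a b => by
      have h1 : pushoutMk NX NK A B (v a b) = pushoutMk NX NK A B (0, k a b) :=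
        congrFun (congrFun hv a) b
      rw [← sub_eq_zero, ← map_sub, h.pushoutMk_eq_zero_iff hK hB] at h1
      obtain ⟨y, hy1, hy2⟩ := h1
      refine ⟨y, by simpa using hy1, ?_⟩
      rw [neg_eq_iff_eq_neg] at hy2
      simpa using hy2
    choose y hy1 hy2 using hy
    have h1 := hC n (Matrix.of y)
    have h2 := hD n (Matrix.of y)
    have e1 : (Matrix.of y).map A = v.map Prod.fst := by ext a b; exact hy1 a b
    have e2 : k = (Matrix.of y).map B + v.map Prod.snd := by
      ext a b
      simp [hy2]
    rw [e1] at h1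
    have h3 := hK.nrm_add_le n ((Matrix.of y).map B) (v.map Prod.snd)
    rw [← e2] at h3
    have h4 := mul_le_mul_of_nonneg_left h1 hD0
    have h5 := mul_le_mul_of_nonneg_left hlt.le (mul_nonneg hD0 hC0)
    rw [div_lt_iff₀' (by positivity)]
    linarith
  refine .of_bounds hK (hX.pushout hK) h.right_operatorSpace ?_ ?_ ?_ ?_ ?_ ⟨_, below⟩ ?_
  · refine (injective_iff_map_eq_zero _).2 fun k hk => ?_
    obtain ⟨y, hy1, hy2⟩ := (h.pushoutMk_eq_zero_iff hK hB (0, k)).1 hk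
    obtain rfl : y = 0 := h.injective (by rw [hy1, map_zero])
    simpa using hy2.symm
  · intro w
    obtain ⟨⟨x, k⟩, rfl⟩ := pushoutMk_surjective NX NK A B w
    rw [hq, h.exact]
    constructor
    · rintro ⟨y, rfl⟩
      -- Subtracting `(A y, -B y)` from `(A y, k)` gives `(0, k + B y)`.
      refine ⟨k + B y, ?_⟩
      rw [← sub_eq_zero, pushoutInr, LinearMap.comp_apply, ← map_sub,
        h.pushoutMk_eq_zero_iff hK hB]
      exact ⟨-y, by simp, by simp⟩
    · rintro ⟨k', hk'⟩
      rw [← sub_eq_zero, pushoutInr, LinearMap.comp_apply, ← map_sub,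
        h.pushoutMk_eq_zero_iff hK hB] at hk'
      obtain ⟨y, hy, -⟩ := hk'
      exact ⟨-y, by simp [hy]⟩
  · intro z
    obtain ⟨x, rfl⟩ := h.surjective z
    exact ⟨pushoutMk NX NK A B (x, 0), hq x 0⟩
  · refine ⟨1, fun n k => ?_⟩
    have h1 := pushoutNorms_le (A := A) (B := B) hX hK (k.map fun a => ((0 : X), a))
    have h2 : (k.map fun a => ((0 : X), a)).map Prod.fst = 0 := by ext; rfl
    have h3 : (k.map fun a => ((0 : X), a)).map Prod.snd = k := by ext; rfl
    rw [h2, h3, hX.nrm_zero, max_eq_right (hK.nrm_nonneg n k)] at h1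
    rw [one_mul]
    exact h1
  · obtain ⟨E, hE0, hE⟩ := h.right_cb.exists_nonneg hX
    refine ⟨E + 1, fun n w => ?_⟩
    rw [← div_le_iff₀' (by positivity)]
    refine le_of_forall_gt fun r hr => ?_
    obtain ⟨v, rfl, hlt, -⟩ := exists_pushout_rep_lt _ hr
    have h1 : (v.map (pushoutMk NX NK A B)).map q = (v.map Prod.fst).map Q := by
      ext a b
      exact hq _ _
    have h2 := hX.nrm_nonneg n (v.map Prod.fst)
    rw [div_lt_iff₀' (by positivity), h1]
    nlinarith [hE n (v.map Prod.fst)]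
  · obtain ⟨E, hE⟩ := h.right_lift
    refine ⟨E, fun n z ε hε => ?_⟩
    obtain ⟨x, rfl, hx⟩ := hE n z ε hε
    have h1 := pushoutNorms_le (A := A) (B := B) hX hK (x.map fun a => (a, (0 : K)))
    have h2 : (x.map fun a => (a, (0 : K))).map Prod.fst = x := by ext; rfl
    have h3 : (x.map fun a => (a, (0 : K))).map Prod.snd = 0 := by ext; rfl
    rw [h2, h3, hK.nrm_zero, max_eq_left (hX.nrm_nonneg n x)] at h1
    refine ⟨_, ?_, h1.trans hx⟩
    ext a b
    exact hq _ _

/-- If `J : X → X'` is a complete quotient map with kernel contained in `A (ker B)`, and matrices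
lift along `B` with uniform control of the norms, then `X'` is completely isomorphic to the
pushout. -/
theorem IsExtensionSequence.pushout_isCompleteIso (h : IsExtensionSequence NY NX NZ A Q)
    (hK : NK.IsOperatorSpace) (hB : IsCompletelyBounded NY NK B)
    (hBlift : ∃ C : ℝ, ∀ (n : ℕ) (k : Matrix (Fin n) (Fin n) K), ∀ ε > 0,
      ∃ y : Matrix (Fin n) (Fin n) Y, y.map B = k ∧ NY.nrm n y ≤ C * NK.nrm n k + ε)
    {J : X →ₗ[ℂ] X'} (hJ : Function.Surjective J)
    (hker : ∀ x, J x = 0 → ∃ y, A y = x ∧ B y = 0) {j : K →ₗ[ℂ] X'}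
    (hj : ∀ y, j (B y) = J (A y)) {T : Pushout NX NK A B →ₗ[ℂ] X'}
    (hT : ∀ x k, T (pushoutMk NX NK A B (x, k)) = J x + j k) :
    IsCompleteIso (pushoutNorms NX NK A B) (NX.quotientAlong J) T := by
  have hX := h.mid_operatorSpace
  obtain ⟨C, hC⟩ := hBlift
  have hBsurj : Function.Surjective B := fun k => by
    obtain ⟨y, hy, -⟩ := hC 1 (fun _ _ => k) 1 one_pos
    exact ⟨y 0 0, congrFun (congrFun hy 0) 0⟩
  have inj : Function.Injective T := by
    refine (injective_iff_map_eq_zero _).2 fun w hw => ?_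
    obtain ⟨⟨x, k⟩, rfl⟩ := pushoutMk_surjective NX NK A B w
    -- Modulo `Δ`, `(x, B y)` equals `(x + A y, 0)`, so `T` vanishes on it only if `x + A y` lies in
    -- the kernel of `J`.
    obtain ⟨y, rfl⟩ := hBsurj k
    rw [hT, hj, ← map_add] at hw
    obtain ⟨y', hy', hB'⟩ := hker _ hw
    exact (h.pushoutMk_eq_zero_iff hK hB _).2 ⟨y' - y, by simp [hy'], by simp [hB']⟩
  have surj : Function.Surjective T := fun z => by
    obtain ⟨x, rfl⟩ := hJ z
    exact ⟨pushoutMk NX NK A B (x, 0), by simp [hT]⟩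
  refine ⟨LinearEquiv.ofBijective T ⟨inj, surj⟩, LinearMap.ext fun _ => rfl, ?_, ?_⟩
  · obtain ⟨D, hD0, hD⟩ := h.left_cb.exists_nonneg h.left_operatorSpace
    -- With `B y = v₂`, the matrix `v₁ + A y` lifts the image of `(v₁, v₂)` along `J`, and its norm
    -- is at most `‖v₁‖ + D C ‖v₂‖` up to the lifting error.
    refine ⟨1 + D * max C 0, fun n w => ?_⟩
    rw [← div_le_iff₀' (by positivity)]
    refine le_of_forall_gt fun r hr => ?_
    obtain ⟨v, rfl, hlt, hlt'⟩ := exists_pushout_rep_lt _ hr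
    -- The lifting error is taken from the gap `r - ‖v₁‖`: after multiplication by `D` it uses at
    -- most half of it, so the strict inequality survives.
    have hr0 : 0 < r - NX.nrm n (v.map Prod.fst) := sub_pos.2 hlt
    obtain ⟨y, hy, hyC⟩ := hC n (v.map Prod.snd) ((r - NX.nrm n (v.map Prod.fst)) / (D + 1) / 2)
      (by positivity)
    have h1 := hX.quotientAlong_le J (x := v.map Prod.fst + y.map A)
      (y := (v.map (pushoutMk NX NK A B)).map T) (by
        ext a b
        have hab : B (y a b) = (v a b).2 := congrFun (congrFun hy a) b
        simp only [Matrix.map_apply, Matrix.add_apply, map_add, ← hj, hab]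
        exact (hT _ _).symm)
    have h2 := hX.nrm_add_le n (v.map Prod.fst) (y.map A)
    have h3 := hD n y
    have h4 := mul_le_mul_of_nonneg_left hyC hD0
    have h5 : D * ((r - NX.nrm n (v.map Prod.fst)) / (D + 1) / 2) ≤
        (r - NX.nrm n (v.map Prod.fst)) / 2 := by
      rw [mul_div_assoc', mul_div_assoc']
      gcongr
      rw [div_le_iff₀ (by positivity)]
      nlinarith
    have h6 : C * NK.nrm n (v.map Prod.snd) ≤ max C 0 * r :=
      mul_le_mul (le_max_left _ _) hlt'.le (hK.nrm_nonneg _ _) (le_max_right _ _)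
    have h7 := mul_le_mul_of_nonneg_left h6 hD0
    rw [div_lt_iff₀' (by positivity)]
    refine h1.trans_lt ?_
    linarith
  -- The inverse sends `J x` to the class of `(x, 0)`, so every lift of `z` along `J` is a
  -- representative of the same norm.
  · refine ⟨1, fun n z => ?_⟩
    rw [one_mul]
    refine NX.le_quotientAlong hJ z fun x hx => ?_
    have h1 := pushoutNorms_le (A := A) (B := B) hX hK (x.map fun a => (a, (0 : K)))
    have h2 : (x.map fun a => (a, (0 : K))).map Prod.fst = x := by ext; rfl
    have h3 : (x.map fun a => (a, (0 : K))).map Prod.snd = 0 := by ext; rfl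
    rw [h2, h3, hK.nrm_zero, max_eq_left (hX.nrm_nonneg n x)] at h1
    refine (le_of_eq (congrArg _ ?_)).trans h1
    ext a b
    refine (LinearEquiv.symm_apply_eq _).2 ?_
    have hab : J (x a b) = z a b := congrFun (congrFun hx a) b
    rw [← hab]
    exact (by simpa using (hT (x a b) 0).symm : J (x a b) = T _)

end Pushout

end

/-! ### Bounded continuous functions with values in an operator space -/

namespace MatrixNorms

/-- The supremum norms on matrices of bounded continuous functions. -/
def boundedContinuous {E : Type*} [NormedAddCommGroup E] (N : MatrixNorms E) :
    MatrixNorms (ℝ →ᵇ E) where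
  nrm n f := ⨆ t : ℝ, N.nrm n (f.map fun a => a t)

theorem boundedContinuous_one {E : Type*} [NormedAddCommGroup E] {N : MatrixNorms E}
    (hone : ∀ x, N.one x = ‖x‖) (f : ℝ →ᵇ E) : N.boundedContinuous.one f = ‖f‖ := by
  rw [BoundedContinuousFunction.norm_eq_iSup_norm]
  exact iSup_congr fun t => hone (f t)

variable {E : Type*} [NormedAddCommGroup E] [NormedSpace ℂ E] {N : MatrixNorms E}

/-- A real supremum over an unbounded set is 0 by convention, so pointwise values are dominated by
it only once boundedness is known. -/
theorem IsOperatorSpace.bddAbove_nrm_apply (h : N.IsOperatorSpace) (hone : ∀ x, N.one x = ‖x‖)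
    {n : ℕ} (f : Matrix (Fin n) (Fin n) (ℝ →ᵇ E)) :
    BddAbove (Set.range fun t : ℝ => N.nrm n (f.map fun a => a t)) := by
  refine ⟨∑ i, ∑ j, ‖f i j‖, ?_⟩
  rintro _ ⟨t, rfl⟩
  refine (h.nrm_le_sum_one _).trans (Finset.sum_le_sum fun i _ => Finset.sum_le_sum fun j _ => ?_)
  rw [hone]
  exact (f i j).norm_coe_le_norm t

theorem IsOperatorSpace.nrm_apply_le (h : N.IsOperatorSpace) (hone : ∀ x, N.one x = ‖x‖)
    {n : ℕ} (f : Matrix (Fin n) (Fin n) (ℝ →ᵇ E)) (t : ℝ) :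
    N.nrm n (f.map fun a => a t) ≤ N.boundedContinuous.nrm n f :=
  le_ciSup (h.bddAbove_nrm_apply hone f) t

theorem IsOperatorSpace.boundedContinuous_nonneg (h : N.IsOperatorSpace) {n : ℕ}
    (f : Matrix (Fin n) (Fin n) (ℝ →ᵇ E)) : 0 ≤ N.boundedContinuous.nrm n f :=
  Real.iSup_nonneg fun _ => h.nrm_nonneg n _

/-- At each `t` the whole matrix is multiplied by the single scalar `a t`, so the bound does not
depend on `n`. -/
theorem IsOperatorSpace.boundedContinuous_smul_le (h : N.IsOperatorSpace)
    (hone : ∀ x, N.one x = ‖x‖) {n : ℕ} (a : ℝ →ᵇ ℂ) {f g : Matrix (Fin n) (Fin n) (ℝ →ᵇ E)}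
    (hg : ∀ i j, g i j = a • f i j) :
    N.boundedContinuous.nrm n g ≤ ‖a‖ * N.boundedContinuous.nrm n f := by
  refine ciSup_le fun t => ?_
  have h1 : (g.map fun b => b t) = a t • f.map fun b => b t := by
    ext i j
    simp only [Matrix.map_apply, hg]
    rfl
  rw [h1, h.nrm_smul]
  exact mul_le_mul (a.norm_coe_le_norm t) (h.nrm_apply_le hone f t) (h.nrm_nonneg n _)
    (norm_nonneg a)

/-- Evaluation at a point, as a linear map. -/
def boundedContinuousEval (E : Type*) [NormedAddCommGroup E] [NormedSpace ℂ E] (t : ℝ) :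
    (ℝ →ᵇ E) →ₗ[ℂ] E where
  toFun f := f t
  map_add' _ _ := rfl
  map_smul' _ _ := rfl

theorem IsOperatorSpace.boundedContinuous (h : N.IsOperatorSpace) (hone : ∀ x, N.one x = ‖x‖) :
    N.boundedContinuous.IsOperatorSpace := by
  have := h.completeSpace_of_one hone
  refine isOperatorSpace_of_directSum_le (fun n f hf => ?_) (fun n f g => ?_) (fun n c f => ?_)
    (exists_limit_of_completeSpace (boundedContinuous_one hone)) (fun m n v w => ?_)
    (fun m n α v β => ?_)
  · ext i j t
    have h1 := (h.nrm_eq_zero n _).1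
      (le_antisymm ((h.nrm_apply_le hone f t).trans hf.le) (h.nrm_nonneg n _))
    exact congrFun (congrFun h1 i) j
  · refine ciSup_le fun t => (h.nrm_add_le n _ _).trans ?_
    exact add_le_add (h.nrm_apply_le hone f t) (h.nrm_apply_le hone g t)
  · refine Eq.trans ?_ (Real.mul_iSup_of_nonneg (norm_nonneg c) _).symm
    exact iSup_congr fun t => h.nrm_smul n c _
  · refine ciSup_le fun t => ?_
    have h1 : (matDirectSum v w).map (fun a => a t) =
        matDirectSum (v.map fun a => a t) (w.map fun a => a t) :=
      matDirectSum_map (boundedContinuousEval E t) v w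
    rw [h1, h.nrm_directSum]
    exact max_le_max (h.nrm_apply_le hone v t) (h.nrm_apply_le hone w t)
  · refine ciSup_le fun t => ?_
    have h1 : (matSandwich α v β).map (fun a => a t) = matSandwich α (v.map fun a => a t) β :=
      matSandwich_map (boundedContinuousEval E t) α v β
    rw [h1]
    refine (h.nrm_sandwich_le m n α _ β).trans ?_
    open scoped Matrix.Norms.L2Operator in
    gcongr
    exact h.nrm_apply_le hone v t

end MatrixNorms

theorem MatrixNorms.boundedContinuous_prod_one {E F : Type*} [NormedAddCommGroup E]
    [NormedAddCommGroup F] {N : MatrixNorms E} {N' : MatrixNorms F} (hone : ∀ x, N.one x = ‖x‖)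
    (hone' : ∀ x, N'.one x = ‖x‖) (g : (ℝ →ᵇ E) × (ℝ →ᵇ F)) :
    (N.boundedContinuous.prod N'.boundedContinuous).one g = ‖g‖ :=
  congrArg₂ max (boundedContinuous_one hone g.1) (boundedContinuous_one hone' g.2)

/-! ### Calderón's space -/

namespace CompatibleCouple

variable {X₀ X₁ U : Type*} [NormedAddCommGroup X₀] [NormedSpace ℂ X₀]
  [NormedAddCommGroup X₁] [NormedSpace ℂ X₁] [AddCommGroup U] [Module ℂ U] [TopologicalSpace U]
  [IsTopologicalAddGroup U] [T2Space U]

theorem norm_inl_le (c : CompatibleCouple X₀ X₁ U) (x : X₀) : ‖c.inl x‖ ≤ ‖x‖ := by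
  simpa using c.norm_le_of_decomp (x := c.inl x) (x₀ := x) (x₁ := 0) (by simp; rfl)

theorem norm_inr_le (c : CompatibleCouple X₀ X₁ U) (x : X₁) : ‖c.inr x‖ ≤ ‖x‖ := by
  simpa using c.norm_le_of_decomp (x := c.inr x) (x₀ := 0) (x₁ := x) (by simp; rfl)

theorem continuous_inl (c : CompatibleCouple X₀ X₁ U) : Continuous c.inl :=
  AddMonoidHomClass.continuous_of_bound c.inl 1 fun x => by simpa using c.norm_inl_le x

theorem continuous_inr (c : CompatibleCouple X₀ X₁ U) : Continuous c.inr :=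
  AddMonoidHomClass.continuous_of_bound c.inr 1 fun x => by simpa using c.norm_inr_le x

/-- Addition maps the complete space `X₀ × X₁` onto `Σ`. One constant 2 compares the sum of two
norms with their maximum; the other leaves room for a decomposition near the infimum. -/
theorem completeSpace_sum (c : CompatibleCouple X₀ X₁ U) [CompleteSpace X₀] [CompleteSpace X₁] :
    CompleteSpace c.Sum := by
  refine completeSpace_of_bounded_lift (E := X₀ × X₁)
    (c.inl.coprod c.inr : X₀ × X₁ →+ c.Sum) 2 (fun x => ?_) 2 fun y => ?_
  · have h1 : ‖c.inl x.1 + c.inr x.2‖ ≤ _ := norm_add_le _ _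
    have h2 := c.norm_inl_le x.1
    have h3 := c.norm_inr_le x.2
    have h4 := norm_fst_le x
    have h5 := norm_snd_le x
    change ‖c.inl x.1 + c.inr x.2‖ ≤ _
    linarith
  · rcases eq_or_ne y 0 with rfl | hy
    · exact ⟨0, map_zero _, by simp⟩
    · have hy' := norm_pos_iff.2 hy
      obtain ⟨x₀, x₁, h, hlt⟩ := c.exists_decomp_lt y (show ‖y‖ < 2 * ‖y‖ by linarith)
      refine ⟨(x₀, x₁), Subtype.ext h, le_trans (max_le ?_ ?_) hlt.le⟩
      · exact le_add_of_nonneg_right (norm_nonneg _)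
      · exact le_add_of_nonneg_left (norm_nonneg _)

/-- The boundary functions of an element of Calderón's space. -/
def boundary (c : CompatibleCouple X₀ X₁ U) : c.Calderon →ₗ[ℂ] (ℝ →ᵇ X₀) × (ℝ →ᵇ X₁) :=
  LinearMap.snd ℂ _ _ ∘ₗ c.calderonSubmodule.subtype

/-- The maximum principle on the strip. -/
theorem norm_apply_le (c : CompatibleCouple X₀ X₁ U) (f : c.Calderon) (z : ℂ) :
    ‖f.1.1 z‖ ≤ ‖c.boundary f‖ := by
  obtain ⟨hz, hcont, ⟨C, hC⟩, hd, h0, h1⟩ := f.2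
  by_cases hzs : z.re ∈ Set.Icc (0 : ℝ) 1
  -- The growth condition holds with both exponents zero, because `f` is bounded.
  · refine PhragmenLindelof.vertical_strip (a := 0) (b := 1) (f := f.1.1) ⟨hd, ?_⟩
      ⟨0, by simp [Real.pi_pos], 0, ?_⟩ (fun w hw => ?_) (fun w hw => ?_) hzs.1 hzs.2
    · rw [Complex.closure_preimage_re, closure_Ioo zero_ne_one]
      exact hcont
    · refine Asymptotics.IsBigO.of_bound C (Filter.Eventually.of_forall fun w => ?_)
      simpa using hC w
    · have hw' : w = w.im * Complex.I := by simpa [hw] using (Complex.re_add_im w).symm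
      rw [hw', h0]
      exact (c.norm_inl_le _).trans ((BoundedContinuousFunction.norm_coe_le_norm _ _).trans
        (norm_fst_le (c.boundary f)))
    · have hw' : w = 1 + w.im * Complex.I := by simpa [hw] using (Complex.re_add_im w).symm
      rw [hw', h1]
      exact (c.norm_inr_le _).trans ((BoundedContinuousFunction.norm_coe_le_norm _ _).trans
        (norm_snd_le (c.boundary f)))
  · rw [hz z hzs, norm_zero]
    exact norm_nonneg _

/-- Zero boundary values force `f = 0` by the maximum principle. Thus `F` can be handled as a space
of pairs of boundary functions. -/
theorem boundary_injective (c : CompatibleCouple X₀ X₁ U) : Function.Injective c.boundary := by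
  refine (injective_iff_map_eq_zero _).2 fun f hf => Subtype.ext (Prod.ext ?_ hf)
  funext z
  exact norm_le_zero_iff.1 (by simpa [hf] using c.norm_apply_le f z)

/-- A function on the strip with the right regularity and boundary values gives an element of
Calderón's space. -/
theorem exists_calderon (c : CompatibleCouple X₀ X₁ U) (G : ℂ → c.Sum)
    (hcont : ContinuousOn G {z : ℂ | z.re ∈ Set.Icc (0 : ℝ) 1})
    (hbdd : ∃ C : ℝ, ∀ z : ℂ, z.re ∈ Set.Icc (0 : ℝ) 1 → ‖G z‖ ≤ C)
    (hdiff : DifferentiableOn ℂ G {z : ℂ | z.re ∈ Set.Ioo (0 : ℝ) 1})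
    (g : (ℝ →ᵇ X₀) × (ℝ →ᵇ X₁)) (h0 : ∀ t : ℝ, G (t * Complex.I) = c.inl (g.1 t))
    (h1 : ∀ t : ℝ, G (1 + t * Complex.I) = c.inr (g.2 t)) :
    ∃ f : c.Calderon, c.boundary f = g ∧
      ∀ z : ℂ, z.re ∈ Set.Icc (0 : ℝ) 1 → f.1.1 z = G z := by
  -- Cutting `G` off outside the closed strip meets the convention for elements of `F` and changes
  -- nothing on the strip.
  set S : Set ℂ := {z : ℂ | z.re ∈ Set.Icc (0 : ℝ) 1}
  have hS : ∀ z ∈ S, S.indicator G z = G z := fun z hz => Set.indicator_of_mem hz G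
  obtain ⟨C, hC⟩ := hbdd
  refine ⟨⟨(S.indicator G, g), fun z hz => Set.indicator_of_notMem (s := S) hz G, hcont.congr hS,
    ⟨max C 0, fun z => ?_⟩, hdiff.congr fun z hz => hS z ⟨hz.1.le, hz.2.le⟩, fun t => ?_,
    fun t => ?_⟩, rfl, hS⟩
  · by_cases hz : z ∈ S
    · exact (congrArg norm (hS z hz)).trans_le ((hC z hz).trans (le_max_left _ _))
    · exact (congrArg norm (Set.indicator_of_notMem hz G)).trans_le (by simp)
  · exact (hS _ (by simp [S])).trans (h0 t)
  · exact (hS _ (by simp [S])).trans (h1 t)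

/-! ### Calderón's space as an operator space -/

variable {N₀ : MatrixNorms X₀} {N₁ : MatrixNorms X₁}

theorem calderonNorms_one (c : CompatibleCouple X₀ X₁ U) (hone₀ : ∀ x, N₀.one x = ‖x‖)
    (hone₁ : ∀ x, N₁.one x = ‖x‖) (f : c.Calderon) :
    (c.calderonNorms N₀ N₁).one f = ‖c.boundary f‖ :=
  MatrixNorms.boundedContinuous_prod_one hone₀ hone₁ (c.boundary f)

/-- Convergence of boundary functions is uniform, so by the maximum principle the functions
themselves are uniformly Cauchy, and completeness of `Σ` gives a limit. It inherits continuity and,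
as a locally uniform limit, holomorphy; its boundary values are the given ones because `X₀` and `X₁`
embed continuously in `Σ`. -/
theorem isClosedSubspace_range_boundary (c : CompatibleCouple X₀ X₁ U) [CompleteSpace X₀]
    [CompleteSpace X₁] (hone₀ : ∀ x, N₀.one x = ‖x‖) (hone₁ : ∀ x, N₁.one x = ‖x‖) :
    (N₀.boundedContinuous.prod N₁.boundedContinuous).IsClosedSubspace
      (LinearMap.range c.boundary) := by
  intro g hg
  have := c.completeSpace_sum
  have hg' : ∀ n : ℕ, ∃ f : c.Calderon, ‖g - c.boundary f‖ < 1 / ((n : ℝ) + 1) := fun n => by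
    obtain ⟨_, ⟨f, rfl⟩, hf⟩ := hg (1 / ((n : ℝ) + 1)) (by positivity)
    rw [MatrixNorms.boundedContinuous_prod_one hone₀ hone₁] at hf
    exact ⟨f, hf⟩
  choose u hu using hg'
  have hlim : Filter.Tendsto (fun n => c.boundary (u n)) Filter.atTop (nhds g) := by
    rw [tendsto_iff_norm_sub_tendsto_zero]
    refine squeeze_zero (fun _ => norm_nonneg _) (fun n => ?_)
      tendsto_one_div_add_atTop_nhds_zero_nat
    rw [norm_sub_rev]
    exact (hu n).le
  have hcauchy : UniformCauchySeqOn (fun n => (u n).1.1) Filter.atTop Set.univ := by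
    refine Metric.uniformCauchySeqOn_iff.2 fun ε hε => ?_
    obtain ⟨k, hk⟩ := Metric.cauchySeq_iff.1 hlim.cauchySeq ε hε
    refine ⟨k, fun m hm n hn z _ => ?_⟩
    have h1 := c.norm_apply_le (u m - u n) z
    rw [map_sub, ← dist_eq_norm] at h1
    rw [dist_eq_norm]
    exact h1.trans_lt (hk m hm n hn)
  have hpt : ∀ z, ∃ y, Filter.Tendsto (fun n => (u n).1.1 z) Filter.atTop (nhds y) := fun z =>
    cauchySeq_tendsto_of_complete (hcauchy.cauchySeq (Set.mem_univ z))
  choose G hG using hpt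
  have hunif : TendstoUniformlyOn (fun n => (u n).1.1) G Filter.atTop Set.univ :=
    hcauchy.tendstoUniformlyOn_of_tendsto fun z _ => hG z
  suffices h : ∃ f : c.Calderon, c.boundary f = g ∧ ∀ z : ℂ, z.re ∈ Set.Icc (0 : ℝ) 1 →
      f.1.1 z = G z from h.imp fun f hf => hf.1
  refine c.exists_calderon G ?_ ⟨‖g‖, fun z _ => ?_⟩ ?_ g (fun t => ?_) fun t => ?_
  · exact (hunif.mono (Set.subset_univ _)).continuousOn
      (Filter.Frequently.of_forall fun n => (u n).2.2.1)
  · exact le_of_tendsto_of_tendsto' (hG z).norm hlim.norm fun n => c.norm_apply_le _ z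
  · exact (hunif.mono (Set.subset_univ _)).tendstoLocallyUniformlyOn.differentiableOn
      (Filter.Eventually.of_forall fun n => (u n).2.2.2.2.1)
      (isOpen_Ioo.preimage Complex.continuous_re)
  · refine tendsto_nhds_unique (hG _) ?_
    have h1 : Filter.Tendsto (fun n => (c.boundary (u n)).1 t) Filter.atTop (nhds (g.1 t)) :=
      ((continuous_eval_const t).comp continuous_fst).tendsto g |>.comp
        hlim
    exact ((c.continuous_inl.tendsto _).comp h1).congr fun n => ((u n).2.2.2.2.2.1 t).symm
  · refine tendsto_nhds_unique (hG _) ?_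
    have h1 : Filter.Tendsto (fun n => (c.boundary (u n)).2 t) Filter.atTop (nhds (g.2 t)) :=
      ((continuous_eval_const t).comp continuous_snd).tendsto g |>.comp
        hlim
    exact ((c.continuous_inr.tendsto _).comp h1).congr fun n => ((u n).2.2.2.2.2.2 t).symm

theorem isOperatorSpace_calderonNorms (c : CompatibleCouple X₀ X₁ U) (hN₀ : N₀.IsOperatorSpace)
    (hone₀ : ∀ x, N₀.one x = ‖x‖) (hN₁ : N₁.IsOperatorSpace) (hone₁ : ∀ x, N₁.one x = ‖x‖) :
    (c.calderonNorms N₀ N₁).IsOperatorSpace :=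
  have := hN₀.completeSpace_of_one hone₀
  have := hN₁.completeSpace_of_one hone₁
  ((hN₀.boundedContinuous hone₀).prod (hN₁.boundedContinuous hone₁)).comap c.boundary
    c.boundary_injective (c.isClosedSubspace_range_boundary hone₀ hone₁) fun _ _ => rfl

/-- The constant is the same for all `n`. Multiplication and division by `factor θ` both act on
boundary values in this way, which makes their bounds complete ones. -/
theorem calderonNorms_smul_le (c : CompatibleCouple X₀ X₁ U) (hN₀ : N₀.IsOperatorSpace)
    (hone₀ : ∀ x, N₀.one x = ‖x‖) (hN₁ : N₁.IsOperatorSpace) (hone₁ : ∀ x, N₁.one x = ‖x‖)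
    {n : ℕ} (a : ℝ →ᵇ ℂ) (b : ℝ →ᵇ ℂ) {f g : Matrix (Fin n) (Fin n) c.Calderon}
    (hg : ∀ i j, c.boundary (g i j) = (a • (c.boundary (f i j)).1, b • (c.boundary (f i j)).2)) :
    (c.calderonNorms N₀ N₁).nrm n g ≤ max ‖a‖ ‖b‖ * (c.calderonNorms N₀ N₁).nrm n f := by
  have h0 := hN₀.boundedContinuous_smul_le hone₀ (n := n) a
    (f := f.map fun x => (c.boundary x).1) (g := g.map fun x => (c.boundary x).1)
    fun i j => by simp [hg]
  have h1 := hN₁.boundedContinuous_smul_le hone₁ (n := n) b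
    (f := f.map fun x => (c.boundary x).2) (g := g.map fun x => (c.boundary x).2)
    fun i j => by simp [hg]
  refine max_le (h0.trans ?_) (h1.trans ?_)
  · exact mul_le_mul (le_max_left _ _) (le_max_left _ _) (hN₀.boundedContinuous_nonneg _)
      ((norm_nonneg a).trans (le_max_left _ _))
  · exact mul_le_mul (le_max_right _ _) (le_max_right _ _) (hN₁.boundedContinuous_nonneg _)
      ((norm_nonneg a).trans (le_max_left _ _))

end CompatibleCouple

/-! ### Division and multiplication by a function with a simple zero at `θ` -/

namespace StripMultiplier

/-- A function bounded and holomorphic on the closed strip, with a simple zero at `θ` and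
derivative `1` there. -/
def factor (θ : ℝ) (z : ℂ) : ℂ := (θ + 1) * ((z - θ) / (z + 1))

variable {θ : ℝ}

theorem one_le_norm_add_one {z : ℂ} (hz : 0 ≤ z.re) : 1 ≤ ‖z + 1‖ := by
  have h := Complex.re_le_norm (z + 1)
  simp only [Complex.add_re, Complex.one_re] at h
  linarith

theorem add_one_ne_zero {z : ℂ} (hz : 0 ≤ z.re) : z + 1 ≠ 0 :=
  norm_pos_iff.1 (one_pos.trans_le (one_le_norm_add_one hz))

theorem norm_theta_add_one (hθ : θ ∈ Set.Ioo (0 : ℝ) 1) : ‖(θ : ℂ) + 1‖ = θ + 1 := by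
  have h : (θ : ℂ) + 1 = ((θ + 1 : ℝ) : ℂ) := by push_cast; rfl
  rw [h, Complex.norm_real, Real.norm_of_nonneg (by linarith [hθ.1])]

theorem theta_add_one_ne_zero (hθ : θ ∈ Set.Ioo (0 : ℝ) 1) : (θ : ℂ) + 1 ≠ 0 :=
  add_one_ne_zero (by simpa using hθ.1.le)

/-- From `z - θ = (z + 1) - (θ + 1)` and `‖z + 1‖ ≥ 1`, the quotient has norm at most `1 + (θ + 1)`.
-/
theorem norm_factor_le (hθ : θ ∈ Set.Ioo (0 : ℝ) 1) {z : ℂ} (hz : 0 ≤ z.re) :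
    ‖factor θ z‖ ≤ (θ + 1) * (θ + 2) := by
  have h1 := one_le_norm_add_one hz
  have h2 : ‖z - θ‖ ≤ ‖z + 1‖ + (θ + 1) := by
    have := norm_sub_le (z + 1) ((θ : ℂ) + 1)
    rwa [norm_theta_add_one hθ, add_sub_add_right_eq_sub] at this
  rw [factor, norm_mul, norm_div, norm_theta_add_one hθ]
  refine mul_le_mul_of_nonneg_left ?_ (by linarith [hθ.1])
  rw [div_le_iff₀ (by linarith)]
  nlinarith [hθ.1]

/-- From `z + 1 = (z - θ) + (θ + 1)`, the inverse has norm at most `1 / (θ + 1) + 1 / ‖z - θ‖`. This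
serves both the boundary lines and the complement of a disc about `θ`. -/
theorem norm_inv_factor_le (hθ : θ ∈ Set.Ioo (0 : ℝ) 1) {r : ℝ} (hr : 0 < r) {z : ℂ}
    (hzr : r ≤ ‖z - θ‖) : ‖(factor θ z)⁻¹‖ ≤ 1 + 1 / r := by
  have h2 : ‖z + 1‖ ≤ ‖z - θ‖ + (θ + 1) := by
    have := norm_add_le (z - θ) ((θ : ℂ) + 1)
    rwa [norm_theta_add_one hθ, show z - θ + ((θ : ℂ) + 1) = z + 1 by ring] at this
  have h3 : 0 < θ + 1 := by linarith [hθ.1]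
  have h4 : 0 < ‖z - θ‖ := hr.trans_le hzr
  have h5 : θ + 1 ≤ (θ + 1) * (1 / r) * ‖z - θ‖ := by
    rw [mul_assoc, div_mul_eq_mul_div, one_mul]
    exact le_mul_of_one_le_right h3.le ((one_le_div hr).2 hzr)
  rw [factor, mul_inv, inv_div, norm_mul, norm_div, norm_inv, norm_theta_add_one hθ,
    inv_mul_le_iff₀ h3, div_le_iff₀ h4]
  nlinarith [hθ.1]

theorem factor_ne_zero (hθ : θ ∈ Set.Ioo (0 : ℝ) 1) {z : ℂ} (hz : 0 ≤ z.re) (hzθ : z ≠ θ) :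
    factor θ z ≠ 0 :=
  mul_ne_zero (theta_add_one_ne_zero hθ) (div_ne_zero (sub_ne_zero.2 hzθ) (add_one_ne_zero hz))

theorem differentiableAt_factor {z : ℂ} (hz : 0 ≤ z.re) : DifferentiableAt ℂ (factor θ) z := by
  unfold factor
  fun_prop (disch := exact add_one_ne_zero hz)

theorem factor_self : factor θ θ = 0 := by simp [factor]

theorem hasDerivAt_factor (hθ : θ ∈ Set.Ioo (0 : ℝ) 1) : HasDerivAt (factor θ) 1 θ := by
  have h := theta_add_one_ne_zero hθ
  have h1 := (((hasDerivAt_id (θ : ℂ)).sub_const (θ : ℂ)).div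
    ((hasDerivAt_id (θ : ℂ)).add_const 1) h).const_mul ((θ : ℂ) + 1)
  refine h1.congr_deriv ?_
  simp only [id_eq, sub_self]
  field_simp
  ring

/-- The restriction of a function to a vertical line, if it is bounded and continuous there. -/
def onLine (w : ℂ → ℂ) (x : ℝ) (hw : Continuous fun t : ℝ => w (x + t * Complex.I)) (C : ℝ)
    (hC : ∀ t : ℝ, ‖w (x + t * Complex.I)‖ ≤ C) : ℝ →ᵇ ℂ :=
  BoundedContinuousFunction.ofNormedAddCommGroup (fun t : ℝ => w (x + t * Complex.I)) hw C hC

theorem continuous_factor_line {x : ℝ} (hx : 0 ≤ x) :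
    Continuous fun t : ℝ => factor θ (x + t * Complex.I) :=
  continuous_iff_continuousAt.2 fun t =>
    ContinuousAt.comp (f := fun t : ℝ => (x : ℂ) + t * Complex.I) (g := factor θ)
      (differentiableAt_factor (by simpa using hx)).continuousAt (by fun_prop)

theorem abs_sub_le_norm_line (x t : ℝ) : |x - θ| ≤ ‖(x + t * Complex.I : ℂ) - θ‖ := by
  simpa using Complex.abs_re_le_norm ((x + t * Complex.I : ℂ) - θ)

theorem line_ne {x : ℝ} (hx : x ≠ θ) (t : ℝ) : (x + t * Complex.I : ℂ) ≠ θ := fun h =>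
  hx (by simpa using congrArg Complex.re h)

/-- The factor on a boundary line. -/
def factorLine (hθ : θ ∈ Set.Ioo (0 : ℝ) 1) {x : ℝ} (hx : 0 ≤ x) : ℝ →ᵇ ℂ :=
  onLine (factor θ) x (continuous_factor_line hx) _ fun _ => norm_factor_le hθ (by simpa using hx)

/-- The inverse of the factor on a boundary line. -/
def invFactorLine (hθ : θ ∈ Set.Ioo (0 : ℝ) 1) {x : ℝ} (hx : 0 ≤ x) (hxθ : x ≠ θ) : ℝ →ᵇ ℂ :=
  onLine (fun z => (factor θ z)⁻¹) x
    ((continuous_factor_line hx).inv₀ fun t => factor_ne_zero hθ (by simpa using hx)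
      (line_ne hxθ t)) _
    fun t => norm_inv_factor_le hθ (abs_pos.2 (sub_ne_zero.2 hxθ)) (abs_sub_le_norm_line x t)

end StripMultiplier

namespace CompatibleCouple

open StripMultiplier

variable {X₀ X₁ U : Type*} [NormedAddCommGroup X₀] [NormedSpace ℂ X₀]
  [NormedAddCommGroup X₁] [NormedSpace ℂ X₁] [AddCommGroup U] [Module ℂ U] [TopologicalSpace U]
  [IsTopologicalAddGroup U] [T2Space U] {θ : ℝ}

theorem strip_mem_nhds (hθ : θ ∈ Set.Ioo (0 : ℝ) 1) :
    {z : ℂ | z.re ∈ Set.Ioo (0 : ℝ) 1} ∈ nhds (θ : ℂ) :=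
  (isOpen_Ioo.preimage Complex.continuous_re).mem_nhds (by simpa using hθ)

theorem deriv_eq_of_eqOn (hθ : θ ∈ Set.Ioo (0 : ℝ) 1) {E : Type*} [NormedAddCommGroup E]
    [NormedSpace ℂ E] {f G : ℂ → E} (h : ∀ z : ℂ, z.re ∈ Set.Icc (0 : ℝ) 1 → f z = G z) :
    deriv f θ = deriv G θ :=
  Filter.EventuallyEq.deriv_eq
    (Filter.mem_of_superset (strip_mem_nhds hθ) fun z hz => h z ⟨hz.1.le, hz.2.le⟩)

/-- Multiplication by `factor θ`. -/
theorem exists_mul_factor (c : CompatibleCouple X₀ X₁ U) (hθ : θ ∈ Set.Ioo (0 : ℝ) 1) :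
    ∃ a b : ℝ →ᵇ ℂ, ∀ g : c.Calderon, ∃ f : c.Calderon,
      c.boundary f = (a • (c.boundary g).1, b • (c.boundary g).2) ∧
      c.eval θ f = 0 ∧ c.evalDeriv θ hθ f = c.eval θ g := by
  refine ⟨factorLine hθ le_rfl, factorLine hθ zero_le_one, fun g => ?_⟩
  obtain ⟨-, hcont, ⟨C, hC⟩, hd, h0, h1⟩ := g.2
  obtain ⟨f, hf, hfG⟩ : ∃ f : c.Calderon, c.boundary f = _ ∧ ∀ z : ℂ, z.re ∈ Set.Icc (0 : ℝ) 1 →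
      f.1.1 z = factor θ z • g.1.1 z := by
    refine c.exists_calderon (fun z => factor θ z • g.1.1 z) ?_ ⟨(θ + 1) * (θ + 2) * C, ?_⟩ ?_
      (factorLine hθ le_rfl • (c.boundary g).1, factorLine hθ zero_le_one • (c.boundary g).2)
      (fun t => ?_) fun t => ?_
    · exact ContinuousOn.smul (fun z hz =>
        (differentiableAt_factor hz.1).continuousAt.continuousWithinAt) hcont
    · intro z hz
      rw [norm_smul]
      exact mul_le_mul (norm_factor_le hθ hz.1) (hC z) (norm_nonneg _)
        (by nlinarith [hθ.1])
    · exact DifferentiableOn.smul (fun z hz =>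
        (differentiableAt_factor hz.1.le).differentiableWithinAt) hd
    · have e : factorLine hθ le_rfl t = factor θ (t * Complex.I) := by
        simp [factorLine, onLine]
      change _ = c.inl (factorLine hθ le_rfl t • g.1.2.1 t)
      rw [h0, e, map_smul]
    · have e : factorLine hθ zero_le_one t = factor θ (1 + t * Complex.I) := by
        simp [factorLine, onLine]
      change _ = c.inr (factorLine hθ zero_le_one t • g.1.2.2 t)
      rw [h1, e, map_smul]
  refine ⟨f, hf, ?_, ?_⟩
  · refine (hfG θ (by simpa using ⟨hθ.1.le, hθ.2.le⟩)).trans ?_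
    rw [factor_self, zero_smul]
  · refine (deriv_eq_of_eqOn hθ hfG).trans ?_
    -- The factor is 0 at `θ` with derivative 1, so the product rule leaves only `g(θ)`.
    have h := (hasDerivAt_factor hθ).smul (c.differentiableAt_of_mem hθ g).hasDerivAt
    refine h.deriv.trans ?_
    rw [factor_self, zero_smul, one_smul, zero_add]
    rfl

/-- Division by `factor θ`. -/
theorem exists_div_factor (c : CompatibleCouple X₀ X₁ U) [CompleteSpace X₀] [CompleteSpace X₁]
    (hθ : θ ∈ Set.Ioo (0 : ℝ) 1) :
    ∃ a b : ℝ →ᵇ ℂ, ∀ f : c.Calderon, c.eval θ f = 0 → ∃ g : c.Calderon,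
      c.boundary g = (a • (c.boundary f).1, b • (c.boundary f).2) ∧
      c.eval θ g = c.evalDeriv θ hθ f := by
  have := c.completeSpace_sum
  refine ⟨invFactorLine hθ le_rfl hθ.1.ne, invFactorLine hθ zero_le_one hθ.2.ne', fun f hf => ?_⟩
  obtain ⟨-, hcont, ⟨C, hC⟩, hd, h0, h1⟩ := f.2
  have hfθ : f.1.1 θ = 0 := hf
  -- The slope function fills in the removable singularity of `f / factor θ`: away from `θ` the two
  -- agree, and at `θ` the value is `f'(θ)`.
  set G : ℂ → c.Sum := fun z => (((θ : ℂ) + 1)⁻¹ * (z + 1)) • dslope f.1.1 θ z with hG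
  have hGeq : ∀ z : ℂ, z ≠ θ → G z = (factor θ z)⁻¹ • f.1.1 z := fun z hz => by
    rw [hG]
    simp only [factor]
    rw [dslope_of_ne _ hz, slope_def_module, hfθ, sub_zero, smul_smul, mul_inv, inv_div,
      div_eq_mul_inv, mul_assoc]
  have hw : Differentiable ℂ fun z : ℂ => ((θ : ℂ) + 1)⁻¹ * (z + 1) := by fun_prop
  have hnhds : {z : ℂ | z.re ∈ Set.Icc (0 : ℝ) 1} ∈ nhds (θ : ℂ) :=
    Filter.mem_of_superset (strip_mem_nhds hθ) fun z hz => ⟨hz.1.le, hz.2.le⟩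
  have hGcont : ContinuousOn G {z : ℂ | z.re ∈ Set.Icc (0 : ℝ) 1} :=
    hw.continuous.continuousOn.smul
      ((continuousOn_dslope hnhds).2 ⟨hcont, c.differentiableAt_of_mem hθ f⟩)
  -- The inverse factor blows up at `θ`, so `G` is bounded by compactness on a disc about `θ` and
  -- through the inverse factor off that disc.
  obtain ⟨r, hr, hball⟩ := Metric.nhds_basis_closedBall.mem_iff.1 hnhds
  obtain ⟨D, hD⟩ := (isCompact_closedBall (θ : ℂ) r).exists_bound_of_continuousOn
    (hGcont.mono hball)
  obtain ⟨g, hg, hgG⟩ : ∃ g : c.Calderon, c.boundary g = _ ∧ ∀ z : ℂ, z.re ∈ Set.Icc (0 : ℝ) 1 →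
      g.1.1 z = G z := by
    refine c.exists_calderon G hGcont ⟨max D ((1 + 1 / r) * C), fun z _ => ?_⟩ ?_
      (invFactorLine hθ le_rfl hθ.1.ne • (c.boundary f).1,
        invFactorLine hθ zero_le_one hθ.2.ne' • (c.boundary f).2)
      (fun t => ?_) fun t => ?_
    · by_cases hz : z ∈ Metric.closedBall (θ : ℂ) r
      · exact (hD z hz).trans (le_max_left _ _)
      · rw [Metric.mem_closedBall, not_le, dist_eq_norm] at hz
        have hzθ : z ≠ θ := by
          rintro rfl
          simp only [sub_self, norm_zero] at hz
          exact hr.not_gt hz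
        rw [hGeq z hzθ, norm_smul]
        exact (mul_le_mul (norm_inv_factor_le hθ hr hz.le) (hC z) (norm_nonneg _)
          (by positivity)).trans (le_max_right _ _)
    · exact hw.differentiableOn.smul
        ((Complex.differentiableOn_dslope (strip_mem_nhds hθ)).2 hd)
    · have e : invFactorLine hθ le_rfl hθ.1.ne t = (factor θ (t * Complex.I))⁻¹ := by
        simp [invFactorLine, onLine]
      change _ = c.inl (invFactorLine hθ le_rfl hθ.1.ne t • f.1.2.1 t)
      rw [hGeq _ (by simpa using line_ne hθ.1.ne t), h0, e, map_smul]
    · have e : invFactorLine hθ zero_le_one hθ.2.ne' t = (factor θ (1 + t * Complex.I))⁻¹ := by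
        simp [invFactorLine, onLine]
      change _ = c.inr (invFactorLine hθ zero_le_one hθ.2.ne' t • f.1.2.2 t)
      rw [hGeq _ (by simpa using line_ne hθ.2.ne' t), h1, e, map_smul]
  refine ⟨g, hg, ?_⟩
  refine (hgG θ (by simpa using ⟨hθ.1.le, hθ.2.le⟩)).trans ?_
  simp only [hG]
  rw [dslope_same, inv_mul_cancel₀ (theta_add_one_ne_zero hθ), one_smul]
  rfl

theorem norm_eval_le (c : CompatibleCouple X₀ X₁ U) (f : c.Calderon) :
    ‖c.eval θ f‖ ≤ ‖c.boundary f‖ := c.norm_apply_le f θ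

/-- Cauchy's estimate for the derivative at `θ`. -/
theorem exists_norm_evalDeriv_le (c : CompatibleCouple X₀ X₁ U) (hθ : θ ∈ Set.Ioo (0 : ℝ) 1) :
    ∃ C : ℝ, ∀ f : c.Calderon, ‖c.evalDeriv θ hθ f‖ ≤ C * ‖c.boundary f‖ := by
  obtain ⟨r, hr, hball⟩ := Metric.nhds_basis_closedBall.mem_iff.1 (strip_mem_nhds hθ)
  refine ⟨1 / r, fun f => ?_⟩
  rw [one_div_mul_eq_div]
  refine Complex.norm_deriv_le_of_forall_mem_sphere_norm_le hr ?_ fun z _ => c.norm_apply_le f z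
  refine DifferentiableOn.diffContOnCl ?_
  rw [closure_ball _ hr.ne']
  exact f.2.2.2.2.1.mono hball

end CompatibleCouple

namespace CompatibleCouple

/-! ### The derivation map and the derived space -/

variable {X₀ X₁ U : Type*} [NormedAddCommGroup X₀] [NormedSpace ℂ X₀]
  [NormedAddCommGroup X₁] [NormedSpace ℂ X₁] [AddCommGroup U] [Module ℂ U] [TopologicalSpace U]
  [IsTopologicalAddGroup U] [T2Space U] {θ : ℝ} {N₀ : MatrixNorms X₀} {N₁ : MatrixNorms X₁}

/-- The quotient of `f` by `factor θ` lies in `F` and has the value `f'(θ)` at `θ`. -/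
theorem evalDeriv_mem_interp (c : CompatibleCouple X₀ X₁ U) [CompleteSpace X₀] [CompleteSpace X₁]
    (hθ : θ ∈ Set.Ioo (0 : ℝ) 1) (f : c.evalKer θ) :
    c.evalDeriv θ hθ (f : c.Calderon) ∈ c.interp θ := by
  obtain ⟨a, b, h⟩ := c.exists_div_factor hθ
  obtain ⟨g, -, hg⟩ := h f f.2
  exact ⟨g, hg⟩

/-- The map `δ'_θ : ker δ_θ → X_θ`, `f ↦ f'(θ)`. -/
def evalDerivKer (c : CompatibleCouple X₀ X₁ U) [CompleteSpace X₀] [CompleteSpace X₁]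
    (hθ : θ ∈ Set.Ioo (0 : ℝ) 1) : c.evalKer θ →ₗ[ℂ] c.interp θ :=
  (c.evalDeriv θ hθ ∘ₗ (c.evalKer θ).subtype).codRestrict (c.interp θ) (c.evalDeriv_mem_interp hθ)

/-- If `g(θ) = y`, the product of `g` with `factor θ` has the jet `(0, y)`. -/
theorem zero_prod_mem_derived (c : CompatibleCouple X₀ X₁ U) (hθ : θ ∈ Set.Ioo (0 : ℝ) 1)
    (y : c.interp θ) : ((0 : c.Sum), (y : c.Sum)) ∈ c.derived θ hθ := by
  obtain ⟨_, g, rfl⟩ := y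
  obtain ⟨a, b, h⟩ := c.exists_mul_factor hθ
  obtain ⟨f, -, hf, hf'⟩ := h g
  exact ⟨f, Prod.ext hf hf'⟩

/-- The map `X_θ → dX_θ`, `y ↦ (0, y)`. -/
def derivedInr (c : CompatibleCouple X₀ X₁ U) (hθ : θ ∈ Set.Ioo (0 : ℝ) 1) :
    c.interp θ →ₗ[ℂ] c.derived θ hθ :=
  (LinearMap.inr ℂ c.Sum c.Sum ∘ₗ (c.interp θ).subtype).codRestrict (c.derived θ hθ)
    (c.zero_prod_mem_derived hθ)

theorem isClosedSubspace_evalKer (c : CompatibleCouple X₀ X₁ U) (hN₀ : N₀.IsOperatorSpace)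
    (hone₀ : ∀ x, N₀.one x = ‖x‖) (hN₁ : N₁.IsOperatorSpace) (hone₁ : ∀ x, N₁.one x = ‖x‖) :
    (c.calderonNorms N₀ N₁).IsClosedSubspace (c.evalKer θ) := by
  refine (c.isOperatorSpace_calderonNorms hN₀ hone₀ hN₁ hone₁).isClosedSubspace_ker _ 1 fun f => ?_
  rw [c.calderonNorms_one hone₀ hone₁, one_mul]
  exact c.norm_eval_le f

/-- The jet is bounded into `Σ × Σ`: its value by the maximum principle, its derivative by Cauchy's
estimate. -/
theorem isClosedSubspace_ker_jet (c : CompatibleCouple X₀ X₁ U) (hN₀ : N₀.IsOperatorSpace)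
    (hone₀ : ∀ x, N₀.one x = ‖x‖) (hN₁ : N₁.IsOperatorSpace) (hone₁ : ∀ x, N₁.one x = ‖x‖)
    (hθ : θ ∈ Set.Ioo (0 : ℝ) 1) :
    (c.calderonNorms N₀ N₁).IsClosedSubspace (LinearMap.ker (c.jet θ hθ)) := by
  obtain ⟨C, hC⟩ := c.exists_norm_evalDeriv_le hθ
  refine (c.isOperatorSpace_calderonNorms hN₀ hone₀ hN₁ hone₁).isClosedSubspace_ker _ (max 1 C)
    fun f => ?_
  rw [c.calderonNorms_one hone₀ hone₁]
  refine max_le ((c.norm_eval_le f).trans ?_) ((hC f).trans ?_)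
  · exact le_mul_of_one_le_left (norm_nonneg _) (le_max_left _ _)
  · exact mul_le_mul_of_nonneg_right (le_max_right _ _) (norm_nonneg _)

theorem isExtensionSequence_eval (c : CompatibleCouple X₀ X₁ U) (hN₀ : N₀.IsOperatorSpace)
    (hone₀ : ∀ x, N₀.one x = ‖x‖) (hN₁ : N₁.IsOperatorSpace) (hone₁ : ∀ x, N₁.one x = ‖x‖) :
    IsExtensionSequence (c.evalKerNorms N₀ N₁ θ) (c.calderonNorms N₀ N₁) (c.interpNorms N₀ N₁ θ)
      (c.evalKer θ).subtype (c.evalInterp θ) :=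
  .subtype_ker (c.isOperatorSpace_calderonNorms hN₀ hone₀ hN₁ hone₁)
    (c.eval θ).surjective_rangeRestrict (c.eval θ).ker_rangeRestrict
    (c.isClosedSubspace_evalKer hN₀ hone₀ hN₁ hone₁)

theorem isOperatorSpace_derivedNorms (c : CompatibleCouple X₀ X₁ U) (hN₀ : N₀.IsOperatorSpace)
    (hone₀ : ∀ x, N₀.one x = ‖x‖) (hN₁ : N₁.IsOperatorSpace) (hone₁ : ∀ x, N₁.one x = ‖x‖)
    (hθ : θ ∈ Set.Ioo (0 : ℝ) 1) : (c.derivedNorms N₀ N₁ θ hθ).IsOperatorSpace := by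
  refine (c.isOperatorSpace_calderonNorms hN₀ hone₀ hN₁ hone₁).quotientAlong
    (c.jet θ hθ).surjective_rangeRestrict ?_
  rw [LinearMap.ker_rangeRestrict]
  exact c.isClosedSubspace_ker_jet hN₀ hone₀ hN₁ hone₁ hθ

/-- Dividing every entry by `factor θ` produces a lift to `F` of the matrix of derivatives, at the
cost of the boundary multipliers only. -/
theorem isCompletelyBounded_evalDerivKer (c : CompatibleCouple X₀ X₁ U) [CompleteSpace X₀]
    [CompleteSpace X₁] (hN₀ : N₀.IsOperatorSpace) (hone₀ : ∀ x, N₀.one x = ‖x‖)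
    (hN₁ : N₁.IsOperatorSpace) (hone₁ : ∀ x, N₁.one x = ‖x‖) (hθ : θ ∈ Set.Ioo (0 : ℝ) 1) :
    IsCompletelyBounded (c.evalKerNorms N₀ N₁ θ) (c.interpNorms N₀ N₁ θ) (c.evalDerivKer hθ) := by
  obtain ⟨a, b, h⟩ := c.exists_div_factor hθ
  refine ⟨max ‖a‖ ‖b‖, fun n f => ?_⟩
  choose g hg hg' using fun i j => h (f i j : c.Calderon) (f i j).2
  refine ((c.isOperatorSpace_calderonNorms hN₀ hone₀ hN₁ hone₁).quotientAlong_le (c.evalInterp θ)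
    (x := Matrix.of g) ?_).trans (c.calderonNorms_smul_le hN₀ hone₀ hN₁ hone₁ a b hg)
  ext i j
  exact hg' i j

/-- A nearly optimal lift of `x` to `F` is multiplied entrywise by `factor θ`. This is the lifting
hypothesis that makes the comparison map out of the pushout completely bounded. -/
theorem exists_lift_evalDerivKer (c : CompatibleCouple X₀ X₁ U) [CompleteSpace X₀]
    [CompleteSpace X₁] (hN₀ : N₀.IsOperatorSpace) (hone₀ : ∀ x, N₀.one x = ‖x‖)
    (hN₁ : N₁.IsOperatorSpace) (hone₁ : ∀ x, N₁.one x = ‖x‖) (hθ : θ ∈ Set.Ioo (0 : ℝ) 1) :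
    ∃ C : ℝ, ∀ (n : ℕ) (x : Matrix (Fin n) (Fin n) (c.interp θ)), ∀ ε > 0,
      ∃ f : Matrix (Fin n) (Fin n) (c.evalKer θ), f.map (c.evalDerivKer hθ) = x ∧
        (c.evalKerNorms N₀ N₁ θ).nrm n f ≤ C * (c.interpNorms N₀ N₁ θ).nrm n x + ε := by
  obtain ⟨a, b, h⟩ := c.exists_mul_factor hθ
  set C := max ‖a‖ ‖b‖
  have hC : 0 ≤ C := (norm_nonneg a).trans (le_max_left _ _)
  refine ⟨C, fun n x ε hε => ?_⟩
  obtain ⟨g, rfl, hlt⟩ := (c.calderonNorms N₀ N₁).exists_lift_lt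
    (c.eval θ).surjective_rangeRestrict x
    (lt_add_of_pos_right _ (by positivity : 0 < ε / (C + 1)))
  choose f hf hf0 hf' using fun i j => h (g i j)
  refine ⟨Matrix.of fun i j => ⟨f i j, hf0 i j⟩, ?_, ?_⟩
  · ext i j
    exact hf' i j
  · refine (c.calderonNorms_smul_le hN₀ hone₀ hN₁ hone₁ a b (f := g) hf).trans ?_
    refine (mul_le_mul_of_nonneg_left hlt.le hC).trans ?_
    rw [mul_add]
    refine add_le_add le_rfl ?_
    rw [mul_div_assoc', div_le_iff₀ (by positivity)]
    nlinarith

end CompatibleCouple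

end
/-- The maps `δ' : ker δ_θ → X_θ`, `q : PO → X_θ` and `j : X_θ → dX_θ` are uniquely determined by
the formulas given for them; that they are well defined is part of the claim. -/
theorem proposition3p2 {X₀ X₁ U : Type*}
    [NormedAddCommGroup X₀] [NormedSpace ℂ X₀] [NormedAddCommGroup X₁] [NormedSpace ℂ X₁]
    [AddCommGroup U] [Module ℂ U] [TopologicalSpace U] [IsTopologicalAddGroup U]
    [ContinuousSMul ℂ U] [T2Space U]
    (N₀ : MatrixNorms X₀) (hN₀ : N₀.IsOperatorSpace) (hone₀ : ∀ x, N₀.one x = ‖x‖)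
    (N₁ : MatrixNorms X₁) (hN₁ : N₁.IsOperatorSpace) (hone₁ : ∀ x, N₁.one x = ‖x‖)
    (c : CompatibleCouple X₀ X₁ U) (θ : ℝ) (hθ : θ ∈ Set.Ioo (0 : ℝ) 1) :
    -- `0 → ker δ_θ → F → X_θ → 0` is an extension sequence
    IsExtensionSequence (c.evalKerNorms N₀ N₁ θ) (c.calderonNorms N₀ N₁) (c.interpNorms N₀ N₁ θ)
      (c.evalKer θ).subtype (c.evalInterp θ) ∧
    -- the completely bounded surjection `δ'_θ : ker δ_θ → X_θ`, `f ↦ f'(θ)`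
    ∃ δ' : c.evalKer θ →ₗ[ℂ] c.interp θ,
      (∀ f : c.evalKer θ, (δ' f : c.Sum) = c.evalDeriv θ hθ (f : c.Calderon)) ∧
      IsCompletelyBounded (c.evalKerNorms N₀ N₁ θ) (c.interpNorms N₀ N₁ θ) δ' ∧
      Function.Surjective δ' ∧
    -- the map `q : PO → X_θ`, `(f, x) + Δ ↦ f(θ)`
    ∃ q : Pushout (c.calderonNorms N₀ N₁) (c.interpNorms N₀ N₁ θ) (c.evalKer θ).subtype δ'
        →ₗ[ℂ] c.interp θ,
      (∀ (f : c.Calderon) (x : c.interp θ), q (pushoutMk (c.calderonNorms N₀ N₁) (c.interpNorms N₀ N₁ θ)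
        (c.evalKer θ).subtype δ' (f, x)) = c.evalInterp θ f) ∧
    -- the map `j : X_θ → dX_θ`, `y ↦ (0, y)`
    ∃ j : c.interp θ →ₗ[ℂ] c.derived θ hθ,
      (∀ y : c.interp θ, (j y : c.Sum × c.Sum) = (0, (y : c.Sum))) ∧
      CompletelyEquivalent (c.interpNorms N₀ N₁ θ)
        (pushoutNorms (c.calderonNorms N₀ N₁) (c.interpNorms N₀ N₁ θ) (c.evalKer θ).subtype δ')
        (c.derivedNorms N₀ N₁ θ hθ) (c.interpNorms N₀ N₁ θ)
        (pushoutInr (c.calderonNorms N₀ N₁) (c.interpNorms N₀ N₁ θ) (c.evalKer θ).subtype δ') q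
        j (c.derivedFst θ hθ) := by
  have hX₀ := hN₀.completeSpace_of_one hone₀
  have hX₁ := hN₁.completeSpace_of_one hone₁
  have hE := c.isExtensionSequence_eval (θ := θ) hN₀ hone₀ hN₁ hone₁
  have hK := hE.right_operatorSpace
  have hB := c.isCompletelyBounded_evalDerivKer hN₀ hone₀ hN₁ hone₁ hθ
  have hlift := c.exists_lift_evalDerivKer hN₀ hone₀ hN₁ hone₁ hθ
  obtain ⟨q, hq⟩ := hE.exists_pushout_lift hK hB
    (c.evalInterp θ ∘ₗ LinearMap.fst ℂ c.Calderon (c.interp θ)) fun f => Subtype.ext f.2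
  -- For `f(θ) = 0` the jet of `f` is `(0, f'(θ))`; this compatibility lets the jet and `j` glue to
  -- a map on the pushout.
  have hj : ∀ f : c.evalKer θ, c.derivedInr hθ (c.evalDerivKer hθ f) =
      (c.jet θ hθ).rangeRestrict f := fun f => Subtype.ext (Prod.ext f.2.symm rfl)
  obtain ⟨T, hT⟩ := hE.exists_pushout_lift hK hB
    ((c.jet θ hθ).rangeRestrict.coprod (c.derivedInr hθ)) fun f => by simp [hj]
  have hPO := hE.pushout hK hB (q := q) fun x k => hq (x, k)
  have hTiso : IsCompleteIso _ (c.derivedNorms N₀ N₁ θ hθ) T :=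
    hE.pushout_isCompleteIso hK hB hlift (c.jet θ hθ).surjective_rangeRestrict
    -- A function with zero jet lies in `ker δ_θ` and is killed by `δ'_θ`.
    (fun f hf => ⟨⟨f, congrArg (fun v : c.derived θ hθ => v.1.1) hf⟩, rfl,
      Subtype.ext (congrArg (fun v : c.derived θ hθ => v.1.2) hf)⟩) hj fun x k => hT (x, k)
  have hTj : T ∘ₗ pushoutInr _ _ _ _ = c.derivedInr hθ := by
    ext1 y
    refine (hT (0, y)).trans ?_
    simp
  have hTp : c.derivedFst θ hθ ∘ₗ T = q := by
    ext1 w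
    obtain ⟨⟨f, y⟩, rfl⟩ := pushoutMk_surjective _ _ _ _ w
    rw [LinearMap.comp_apply, hT, hq]
    exact Subtype.ext (add_zero (c.eval θ f))
  refine ⟨hE, c.evalDerivKer hθ, fun f => rfl, hB, fun x => ?_, q, fun f x => hq (f, x),
    c.derivedInr hθ, fun y => rfl, hPO, ?_, T, hTiso, hTj, hTp⟩
  · obtain ⟨C, hC⟩ := hlift
    obtain ⟨f, hf, -⟩ := hC 1 (fun _ _ => x) 1 one_pos
    exact ⟨f 0 0, congrFun (congrFun hf 0) 0⟩
  -- The sequence for `dX_θ` is the pushout sequence transported along `T`, so `j` and `p` need no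
  -- estimates of their own.
  · exact hPO.of_completeIso (c.isOperatorSpace_derivedNorms hN₀ hone₀ hN₁ hone₁ hθ) hTiso hTj hTp
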